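/- All Hilbert spaces are finite-dimensional and complex, $\mathcal B(\mathcal H)$ denotes the linear operators on $\mathcal H$, and $\mathbb N=\{1,2,\dots\}$. $\mathrm{CP}(\mathcal H,\mathcal K)$ is the set of completely positive linear maps $\mathcal B(\mathcal H)\to\mathcal B(\mathcal K)$; a channel is a trace-preserving such map; $\mathcal N\le_{\mathrm{CP}}\mathcal M$ means that $\mathcal M-\mathcal N$ is completely positive. A state is a positive semidefinite operator of trace $1$; a test is an operator $T$ with $0\le T\le I$. A supermap is a linear map $\Theta:\mathcal B(\mathcal B(\mathcal H_1),\mathcal B(\mathcal K_1))\to\mathcal B(\mathcal B(\mathcal H_2),\mathcal B(\mathcal K_2))$; it is completely positive if, acting on half of any bipartite completely positive map, it yields a completely positive map; a superchannel is a completely positive supermap that maps channels to channels. Let $n\in\mathbb N$ and let $\mathcal H_A,\mathcal H_B$ be given. - An $n$-copy *parallel strategy* $(\varphi,T)$ consists of a space $\mathcal H_R$, a state $\varphi$ on $\mathcal H_R\otimes\mathcal H_A^{\otimes n}$ and a test $T$ on $\mathcal H_R\otimes\mathcal H_B^{\otimes n}$. - An $n$-copy *adaptive strategy* $(\varphi,\vec{\mathcal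 A},T)$ consists of spaces $\mathcal H_{R_1},\dots,\mathcal H_{R_n}$, a state $\varphi$ on $\mathcal H_{R_1}\otimes\mathcal H_A$, channels $\mathcal A_i:\mathcal B(\mathcal H_{R_i}\otimes\mathcal H_B)\to\mathcal B(\mathcal H_{R_{i+1}}\otimes\mathcal H_A)$, $1\le i\le n-1$, and a test $T$ on $\mathcal H_{R_n}\otimes\mathcal H_B$. For $\mathcal F\in\mathrm{CP}(\mathcal H_A,\mathcal H_B)$ put $$\Theta_{\vec{\mathcal A}}(\mathcal F^{\otimes n}):=(\mathrm{id}_{R_n}\otimes\mathcal F)\circ\mathcal A_{n-1}\circ(\mathrm{id}_{R_{n-1}}\otimes\mathcal F)\circ\dots\circ\mathcal A_1\circ(\mathrm{id}_{R_1}\otimes\mathcal F).$$ - An $n$-copy *general strategy* $(\varphi,\Theta,T)$ consists of spaces $\mathcal H_R,\mathcal H_{A'},\mathcal H_{B'}$, a superchannel $\Theta:\mathcal B(\mathcal B(\mathcal H_A^{\otimes n}),\mathcal B(\mathcal H_B^{\otimes n}))\to\mathcal B(\mathcal B(\mathcal H_{A'}),\mathcal B(\mathcal H_{B'}))$, a state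 $\varphi$ on $\mathcal H_R\otimes\mathcal H_{A'}$ and a test $T$ on $\mathcal H_R\otimes\mathcal H_{B'}$. For positive semidefinite $P,Q$ and $t\in[0,1]$, the $t$-weighted Kubo–Ando geometric mean is $$Q\#_tP:=\lim_{\varepsilon\searrow0}Q_\varepsilon^{1/2}\big(Q_\varepsilon^{-1/2}P_\varepsilon Q_\varepsilon^{-1/2}\big)^tQ_\varepsilon^{1/2},\qquad P_\varepsilon:=P+\varepsilon I,\quad Q_\varepsilon:=Q+\varepsilon I.$$ For $\mathcal N,\mathcal M\in\mathrm{CP}(\mathcal H_A,\mathcal H_B)$, $\mathcal M\#_t\mathcal N$ is the linear map with $C(\mathcal M\#_t\mathcal N)=C(\mathcal M)\#_tC(\mathcal N)$, where $C(\mathcal F):=\sum_{i,j}|e_i\rangle\langle e_j|\otimes\mathcal F(|e_i\rangle\langle e_j|)$ is the Choi operator with respect to an orthonormal basis $(e_i)$ of $\mathcal H_A$. **Theorem.** Let $\mathcal Y$ be a non-empty finite set, and let $\mathcal N_y\in\mathrm{CP}(\mathcal H_A,\mathcal H_B)$, $y\in\mathcal Y$, and $\mathcal E\in\mathrm{CP}(\mathcal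 H_A,\mathcal H_B)$. The following are equivalent: 1. For every $n\in\mathbb N$ and every $n$-copy general strategy $(\varphi,\Theta,T)$, $$\operatorname{Tr}T(\mathrm{id}_R\otimes\Theta(\mathcal E^{\otimes n}))\varphi\le\max_{y\in\mathcal Y}\operatorname{Tr}T(\mathrm{id}_R\otimes\Theta(\mathcal N_y^{\otimes n}))\varphi.$$ 1′. The same inequality holds for every $n\in\mathbb N$ and all $(\varphi,\Theta,T)$ as in a general strategy, except that the completely positive supermap $\Theta$ is only required to map $\mathcal F^{\otimes n}$ to a channel for every channel $\mathcal F:\mathcal B(\mathcal H_A)\to\mathcal B(\mathcal H_B)$. 2. For every $n\in\mathbb N$ and every $n$-copy adaptive strategy $(\varphi,\vec{\mathcal A},T)$, $$\operatorname{Tr}T\,\Theta_{\vec{\mathcal A}}(\mathcal E^{\otimes n})\varphi\le\max_{y\in\mathcal Y}\operatorname{Tr}T\,\Theta_{\vec{\mathcal A}}(\mathcal N_y^{\otimes n})\varphi.$$ 3. For every $n\in\mathbb N$ and every $n$-copy parallel strategy $(\varphi,T)$, $$\operatorname{Tr}T(\mathrm{id}_R\otimes\mathcal E^{\otimes n})\varphi\le\max_{y\in\mathcal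 Y}\operatorname{Tr}T(\mathrm{id}_R\otimes\mathcal N_y^{\otimes n})\varphi.$$ 4. There is a probability measure $\mu$ on $\mathcal Y$ such that for every $n\in\mathbb N$, $$\mathcal E^{\otimes n}\le_{\mathrm{CP}}\sum_{y\in\mathcal Y}\mu(y)\,\mathcal N_y^{\otimes n}.$$ If, moreover, $\mathcal Y=\{1,2\}$ has exactly two elements, then these are further equivalent to: 5. There is a $t\in[0,1]$ such that $\mathcal N_2\#_t\mathcal N_1$ exists and $\mathcal E\le_{\mathrm{CP}}\mathcal N_2\#_t\mathcal N_1$. -/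

import Mathlib

open Filter Topology
open scoped ComplexOrder MatrixOrder Kronecker

universe u v w

/-- Superoperators `B(ℂ^A) → B(ℂ^B)`, where the finite type `A` labels an orthonormal basis of the
input space and the finite type `B` one of the output space. -/
abbrev Superop (A : Type u) (B : Type v) := Matrix A A ℂ →ₗ[ℂ] Matrix B B ℂ

/-- `id_R ⊗ N`, acting on `B(ℂ^R ⊗ ℂ^A)`. -/
def idTensor (R : Type w) {A : Type u} {B : Type v} (N : Superop A B) :
    Superop (R × A) (R × B) where
  toFun X := Matrix.of fun p q => N (Matrix.of fun a a' => X (p.1, a) (q.1, a')) p.2 q.2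
  map_add' X Y := by
    ext p q
    exact congrFun (congrFun (map_add N (Matrix.of fun a a' => X (p.1, a) (q.1, a'))
      (Matrix.of fun a a' => Y (p.1, a) (q.1, a'))) p.2) q.2
  map_smul' c X := by
    ext p q
    exact congrFun (congrFun (map_smul N c (Matrix.of fun a a' => X (p.1, a) (q.1, a'))) p.2) q.2

theorem idTensor_kronecker {R : Type w} {A : Type u} {B : Type v} (N : Superop A B)
    (X : Matrix R R ℂ) (Z : Matrix A A ℂ) : idTensor R N (X ⊗ₖ Z) = X ⊗ₖ N Z := by
  ext p q
  exact congrFun (congrFun (map_smul N (X p.1 q.1) Z) p.2) q.2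

/-- Complete positivity: `id_{ℂ^k} ⊗ N` preserves positive semidefiniteness for every `k`. -/
def IsCP {A : Type u} {B : Type v} (N : Superop A B) : Prop :=
  ∀ (k : ℕ) (X : Matrix (Fin k × A) (Fin k × A) ℂ),
    X.PosSemidef → (idTensor (Fin k) N X).PosSemidef

/-- Quantum channels: completely positive and trace-preserving superoperators. -/
def IsCPTP {A : Type u} {B : Type v} [Fintype A] [Fintype B] (N : Superop A B) : Prop :=
  IsCP N ∧ ∀ X : Matrix A A ℂ, (N X).trace = X.trace

/-- The order `N ≤_CP M`. -/
def CPLe {A : Type u} {B : Type v} (N M : Superop A B) : Prop := IsCP (M - N)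

/-- The tensor power `N^{⊗n}`, acting on `B((ℂ^A)^{⊗n})`, in matrix elements:
`N^{⊗n}` sends `|a₁⋯aₙ⟩⟨a'₁⋯a'ₙ|` to `N(|a₁⟩⟨a'₁|) ⊗ ⋯ ⊗ N(|aₙ⟩⟨a'ₙ|)`. -/
def tensorPow {A : Type u} {B : Type v} [Fintype A] [DecidableEq A] (n : ℕ) (N : Superop A B) :
    Superop (Fin n → A) (Fin n → B) where
  toFun X := Matrix.of fun b b' =>
    ∑ a, ∑ a', (∏ i, N (Matrix.single (a i) (a' i) 1) (b i) (b' i)) * X a a'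
  map_add' X Y := by
    ext b b'
    simp [mul_add, Finset.sum_add_distrib]
  map_smul' c X := by
    ext b b'
    simp [Finset.mul_sum, mul_left_comm]

/-- `N^{⊗n}(X₁ ⊗ ⋯ ⊗ Xₙ) = N(X₁) ⊗ ⋯ ⊗ N(Xₙ)`. -/
theorem tensorPow_prod {A : Type u} {B : Type v} [Fintype A] [DecidableEq A] (n : ℕ)
    (N : Superop A B) (X : Fin n → Matrix A A ℂ) :
    tensorPow n N (Matrix.of fun a a' => ∏ i, X i (a i) (a' i)) =
      Matrix.of fun b b' => ∏ i, N (X i) (b i) (b' i) := by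
  have key : ∀ (Z : Matrix A A ℂ) (b b' : B),
      N Z b b' = ∑ a, ∑ a', N (Matrix.single a a' 1) b b' * Z a a' := by
    intro Z b b'
    conv_lhs => rw [Matrix.matrix_eq_sum_single Z]
    simp only [map_sum, Matrix.sum_apply]
    refine Finset.sum_congr rfl fun a _ => Finset.sum_congr rfl fun a' _ => ?_
    have h : Matrix.single a a' (Z a a') = Z a a' • Matrix.single a a' (1 : ℂ) := by
      simp [Matrix.smul_single]
    rw [h, map_smul, Matrix.smul_apply, smul_eq_mul, mul_comm]
  ext b b'
  simp only [tensorPow, LinearMap.coe_mk, AddHom.coe_mk, Matrix.of_apply, key (X _),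
    Finset.prod_univ_sum, Fintype.piFinset_univ, ← Finset.prod_mul_distrib]

/-- Density operators. -/
def IsState {A : Type u} [Fintype A] (φ : Matrix A A ℂ) : Prop := φ.PosSemidef ∧ φ.trace = 1

/-- Tests: `0 ≤ T ≤ I`. -/
def IsTest {A : Type u} [DecidableEq A] (T : Matrix A A ℂ) : Prop :=
  T.PosSemidef ∧ (1 - T).PosSemidef

/-- The component of a bipartite superoperator `Λ` at `|c⟩⟨c'| ↦ |d⟩⟨d'|` in the first factor:
`X ↦ ⟨d| Λ(|c⟩⟨c'| ⊗ X) |d'⟩`. -/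
def superopBlock {C D : Type w} {A : Type u} {B : Type v} [DecidableEq C]
    (Λ : Superop (C × A) (D × B)) (c c' : C) (d d' : D) : Superop A B where
  toFun X := Matrix.of fun b b' => Λ (Matrix.single c c' 1 ⊗ₖ X) (d, b) (d', b')
  map_add' X Y := by
    ext b b'
    simp [Matrix.kronecker_add]
  map_smul' r X := by
    ext b b'
    simp [Matrix.kronecker_smul]

/-- The action of a supermap `Θ` on the second half of a bipartite superoperator: `Θ` is applied
to each component with respect to the first factor. -/
def supermapOnHalf {C D : Type w} {A A' : Type u} {B B' : Type v} [Fintype C] [DecidableEq C]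
    (Θ : Superop A B →ₗ[ℂ] Superop A' B') (Λ : Superop (C × A) (D × B)) :
    Superop (C × A') (D × B') where
  toFun X := Matrix.of fun p q => ∑ c, ∑ c',
    Θ (superopBlock Λ c c' p.1 q.1) (Matrix.of fun a a' => X (c, a) (c', a')) p.2 q.2
  map_add' X Y := by
    ext p q
    simp only [Matrix.of_apply, Matrix.add_apply, ← Finset.sum_add_distrib]
    refine Finset.sum_congr rfl fun c _ => Finset.sum_congr rfl fun c' _ => ?_
    exact congrFun (congrFun (map_add (Θ (superopBlock Λ c c' p.1 q.1))
      (Matrix.of fun a a' => X (c, a) (c', a'))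
      (Matrix.of fun a a' => Y (c, a) (c', a'))) p.2) q.2
  map_smul' r X := by
    ext p q
    simp only [Matrix.of_apply, Matrix.smul_apply, Finset.smul_sum, RingHom.id_apply]
    refine Finset.sum_congr rfl fun c _ => Finset.sum_congr rfl fun c' _ => ?_
    exact congrFun (congrFun (map_smul (Θ (superopBlock Λ c c' p.1 q.1)) r
      (Matrix.of fun a a' => X (c, a) (c', a'))) p.2) q.2

/-- If `Λ = M ⊗ N` then `supermapOnHalf Θ Λ = M ⊗ Θ(N)`. -/
theorem supermapOnHalf_tensor {C D : Type w} {A A' : Type u} {B B' : Type v} [Fintype C]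
    [DecidableEq C] (Θ : Superop A B →ₗ[ℂ] Superop A' B') (M : Superop C D) (N : Superop A B)
    (Λ : Superop (C × A) (D × B)) (h : ∀ Z X, Λ (Z ⊗ₖ X) = M Z ⊗ₖ N X)
    (Z : Matrix C C ℂ) (X : Matrix A' A' ℂ) :
    supermapOnHalf Θ Λ (Z ⊗ₖ X) = M Z ⊗ₖ Θ N X := by
  have hb : ∀ c c' d d', superopBlock Λ c c' d d' = M (Matrix.single c c' 1) d d' • N := by
    intro c c' d d'
    ext1 X
    ext b b'
    simp [superopBlock, h]
  have hX : ∀ c c', (Matrix.of fun a a' => (Z ⊗ₖ X) (c, a) (c', a')) = Z c c' • X := by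
    intro c c'; ext a a'; simp
  ext p q
  simp only [supermapOnHalf, LinearMap.coe_mk, AddHom.coe_mk, Matrix.of_apply, hb, hX, map_smul,
    LinearMap.smul_apply, Matrix.smul_apply, smul_eq_mul]
  rw [Matrix.kroneckerMap_apply]
  conv_rhs => rw [Matrix.matrix_eq_sum_single Z]
  simp only [map_sum, Matrix.sum_apply, Finset.sum_mul]
  refine Finset.sum_congr rfl fun c _ => Finset.sum_congr rfl fun c' _ => ?_
  have h2 : Matrix.single c c' (Z c c') = Z c c' • Matrix.single c c' (1 : ℂ) := by
    simp [Matrix.smul_single]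
  rw [h2, map_smul, Matrix.smul_apply, smul_eq_mul]; ring

/-- Completely positive supermaps: acting on half of a completely positive bipartite superoperator
they give a completely positive superoperator. -/
def IsCPSupermap {A A' : Type u} {B B' : Type v}
    (Θ : Superop A B →ₗ[ℂ] Superop A' B') : Prop :=
  ∀ (k l : ℕ) (Λ : Superop (Fin k × A) (Fin l × B)), IsCP Λ → IsCP (supermapOnHalf Θ Λ)

/-- Superchannels: completely positive supermaps that map channels to channels. -/
def IsSuperchannel {A A' : Type u} {B B' : Type v} [Fintype A] [Fintype A'] [Fintype B]
    [Fintype B'] (Θ : Superop A B →ₗ[ℂ] Superop A' B') : Prop :=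
  IsCPSupermap Θ ∧ ∀ N : Superop A B, IsCPTP N → IsCPTP (Θ N)

/-- Completely positive supermaps for which only the `n`-th tensor powers of channels are
required to be mapped to channels. -/
def IsTensorPowSuperchannel {A A' : Type u} {B B' : Type v} [Fintype A] [DecidableEq A]
    [Fintype A'] [Fintype B] [Fintype B'] (n : ℕ)
    (Θ : Superop (Fin n → A) (Fin n → B) →ₗ[ℂ] Superop A' B') : Prop :=
  IsCPSupermap Θ ∧ ∀ N : Superop A B, IsCPTP N → IsCPTP (Θ (tensorPow n N))

/-- `S_𝒜(E^{⊗(k+1)})` for an adaptive strategy with reference systems `R 0, R 1, …` and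
intermediate channels `𝒜 0, 𝒜 1, …`: the superoperator `E` is used `k + 1` times, with `𝒜 i`
between the uses number `i + 1` and `i + 2` (`𝒜 i` with `i ≥ k` plays no role). -/
def adaptiveSuperop {A : Type u} {B : Type v} (E : Superop A B) (R : ℕ → Type w)
    (𝒜 : ∀ i, Superop (R i × B) (R (i + 1) × A)) : ∀ k : ℕ, Superop (R 0 × A) (R k × B)
  | 0 => idTensor (R 0) E
  | k + 1 => idTensor (R (k + 1)) E ∘ₗ 𝒜 k ∘ₗ adaptiveSuperop E R 𝒜 k

section Domination

variable {A B : Type u} [Fintype A] [DecidableEq A] [Fintype B] [DecidableEq B]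
  {Y : Type v} [Fintype Y] [Nonempty Y]

/-- `E` is dominated by the maximum of the `N y` for all general strategies `(φ, Θ, T)`. -/
def DominatedGeneral (N : Y → Superop A B) (E : Superop A B) : Prop :=
  ∀ n : ℕ, 1 ≤ n →
    ∀ (R A' B' : Type u) [Fintype R] [DecidableEq R] [Fintype A'] [DecidableEq A']
      [Fintype B'] [DecidableEq B']
      (Θ : Superop (Fin n → A) (Fin n → B) →ₗ[ℂ] Superop A' B')
      (φ : Matrix (R × A') (R × A') ℂ) (T : Matrix (R × B') (R × B') ℂ),
      IsSuperchannel Θ → IsState φ → IsTest T →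
      (T * idTensor R (Θ (tensorPow n E)) φ).trace.re ≤
        Finset.univ.sup' Finset.univ_nonempty
          fun y => (T * idTensor R (Θ (tensorPow n (N y))) φ).trace.re

/-- The same as `DominatedGeneral`, for the larger class of supermaps that are only required to
map tensor powers of channels to channels. -/
def DominatedTensorPowGeneral (N : Y → Superop A B) (E : Superop A B) : Prop :=
  ∀ n : ℕ, 1 ≤ n →
    ∀ (R A' B' : Type u) [Fintype R] [DecidableEq R] [Fintype A'] [DecidableEq A']
      [Fintype B'] [DecidableEq B']
      (Θ : Superop (Fin n → A) (Fin n → B) →ₗ[ℂ] Superop A' B')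
      (φ : Matrix (R × A') (R × A') ℂ) (T : Matrix (R × B') (R × B') ℂ),
      IsTensorPowSuperchannel n Θ → IsState φ → IsTest T →
      (T * idTensor R (Θ (tensorPow n E)) φ).trace.re ≤
        Finset.univ.sup' Finset.univ_nonempty
          fun y => (T * idTensor R (Θ (tensorPow n (N y))) φ).trace.re

/-- `E` is dominated by the maximum of the `N y` for all `n`-copy adaptive strategies `(φ, 𝒜, T)`,
where `n = m + 1` and `𝒜 0, …, 𝒜 (m - 1)` are the intermediate channels. -/
def DominatedAdaptive (N : Y → Superop A B) (E : Superop A B) : Prop :=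
  ∀ (m : ℕ) (R : ℕ → Type u) [∀ i, Fintype (R i)] [∀ i, DecidableEq (R i)]
    (𝒜 : ∀ i, Superop (R i × B) (R (i + 1) × A))
    (φ : Matrix (R 0 × A) (R 0 × A) ℂ) (T : Matrix (R m × B) (R m × B) ℂ),
    (∀ i, i < m → IsCPTP (𝒜 i)) → IsState φ → IsTest T →
    (T * adaptiveSuperop E R 𝒜 m φ).trace.re ≤
      Finset.univ.sup' Finset.univ_nonempty
        fun y => (T * adaptiveSuperop (N y) R 𝒜 m φ).trace.re

/-- `E` is dominated by the maximum of the `N y` for all parallel strategies `(φ, T)`. -/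
def DominatedParallel (N : Y → Superop A B) (E : Superop A B) : Prop :=
  ∀ n : ℕ, 1 ≤ n →
    ∀ (R : Type u) [Fintype R] [DecidableEq R]
      (φ : Matrix (R × (Fin n → A)) (R × (Fin n → A)) ℂ)
      (T : Matrix (R × (Fin n → B)) (R × (Fin n → B)) ℂ),
      IsState φ → IsTest T →
      (T * idTensor R (tensorPow n E) φ).trace.re ≤
        Finset.univ.sup' Finset.univ_nonempty
          fun y => (T * idTensor R (tensorPow n (N y)) φ).trace.re

/-- A single probability measure `μ` on `Y` satisfies `E^{⊗n} ≤_CP ∑ y, μ(y) N_y^{⊗n}` for all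
`n ≥ 1`. -/
def DominatedMixture (N : Y → Superop A B) (E : Superop A B) : Prop :=
  ∃ μ : Y → ℝ, μ ∈ stdSimplex ℝ Y ∧ ∀ n : ℕ, 1 ≤ n →
    CPLe (tensorPow n E) (∑ y, (μ y : ℂ) • tensorPow n (N y))

end Domination

/-- `Q #_t P = Q^{1/2} (Q^{-1/2} P Q^{-1/2})^t Q^{1/2}` for positive definite `P` and `Q`; powers
are taken in the continuous functional calculus. -/
noncomputable def geomMeanPosDef {ι : Type u} [Fintype ι] [DecidableEq ι] (t : ℝ)
    (Q P : Matrix ι ι ℂ) : Matrix ι ι ℂ :=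
  Q ^ (1 / 2 : ℝ) * (Q ^ (-1 / 2 : ℝ) * P * Q ^ (-1 / 2 : ℝ)) ^ t * Q ^ (1 / 2 : ℝ)

/-- `G` is the `t`-weighted Kubo–Ando mean `Q #_t P` of the positive semidefinite `P` and `Q`. -/
def IsKuboAndoMean {ι : Type u} [Fintype ι] [DecidableEq ι] (t : ℝ) (Q P G : Matrix ι ι ℂ) :
    Prop :=
  Tendsto (fun ε : ℝ => geomMeanPosDef t (Q + (ε : ℂ) • 1) (P + (ε : ℂ) • 1)) (𝓝[>] 0) (𝓝 G)

/-- The Choi matrix `(id ⊗ N)(|Ψ⟩⟨Ψ|)` for the Choi vector `Ψ = ∑ a, e_a ⊗ e_a`. -/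
def choi {A : Type u} {B : Type v} [DecidableEq A] (N : Superop A B) :
    Matrix (A × B) (A × B) ℂ :=
  Matrix.of fun p q => N (Matrix.single p.1 q.1 1) p.2 q.2

/-- `G` is the `t`-weighted Kubo–Ando mean `M #_t N` of the completely positive maps `M` and `N`:
the Choi matrix of `G` is the mean of the Choi matrices. -/
def IsKuboAndoMeanCP {A B : Type u} [Fintype A] [DecidableEq A] [Fintype B] [DecidableEq B]
    (t : ℝ) (M N G : Superop A B) : Prop :=
  IsKuboAndoMean t (choi M) (choi N) (choi G)

/-!
Feeding a maximally entangled state into a parallel strategy and applying a rank-one test probes a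
quadratic form of the tensor power of a Choi matrix. Hence parallel domination yields, for every `n`
and every vector `w`, some `y` with `⟨w, C(E)^{⊗n} w⟩ ≤ ⟨w, C(N y)^{⊗n} w⟩`. The vectors of ratios
of these quadratic forms, one entry for each `y`, are closed under multiplication, because products
of vectors `w` give products of quadratic forms. Once the coordinates `y` at which some ratio
vanishes are discarded, the logarithms form an additive monoid that avoids the open negative
orthant. The convex cone of the monoid avoids it too and can be separated from it. The normalized
separating functional is a probability measure `μ`, and the quadratic forms of `C(E)^{⊗n}` are at
most the `μ`-weighted geometric means of those of the `C(N y)^{⊗n}`. The inequality of arithmetic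
and geometric means turns this into the mixture bound, which every completely positive strategy
preserves, and a mixture is at most its largest component.

For two maps, the bound by geometric means characterizes the matrices below the Kubo–Ando mean.
Congruence reduces this to `Q = 1` and `P` diagonal; there Hölder's inequality gives one direction,
and pinching, which costs only a factor polynomial in `n`, gives the other.
-/

section TensorPower

/-- The `n`-th tensor power `C ⊗ ⋯ ⊗ C` of a matrix, with rows and columns labelled by words of
length `n`. -/
def matTensorPow {ι κ α : Type*} [CommMonoid α] (n : ℕ) (C : Matrix ι κ α) :
    Matrix (Fin n → ι) (Fin n → κ) α :=
  Matrix.of fun a b => ∏ i, C (a i) (b i)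

variable {ι κ l α : Type*}

@[simp]
theorem matTensorPow_apply [CommMonoid α] (n : ℕ) (C : Matrix ι κ α) (a : Fin n → ι)
    (b : Fin n → κ) : matTensorPow n C a b = ∏ i, C (a i) (b i) := rfl

theorem matTensorPow_zero [CommMonoid α] (C : Matrix ι κ α) :
    matTensorPow 0 C = Matrix.of fun _ _ => 1 := by
  ext; simp

theorem matTensorPow_succ [CommSemiring α] (n : ℕ) (C : Matrix ι κ α) :
    matTensorPow (n + 1) C =
      (C ⊗ₖ matTensorPow n C).submatrix (fun a => (a 0, Fin.tail a))
        fun b => (b 0, Fin.tail b) := by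
  ext a b
  simp [Fin.prod_univ_succ, Fin.tail]

theorem matTensorPow_add [CommSemiring α] (m n : ℕ) (C : Matrix ι κ α) :
    matTensorPow (m + n) C = (matTensorPow m C ⊗ₖ matTensorPow n C).submatrix
      (Fin.appendEquiv m n).symm (Fin.appendEquiv m n).symm := by
  ext a b
  simp [Fin.prod_univ_add, Fin.appendEquiv]

theorem matTensorPow_mul [CommSemiring α] [Fintype κ] (n : ℕ) (C : Matrix ι κ α)
    (D : Matrix κ l α) : matTensorPow n (C * D) = matTensorPow n C * matTensorPow n D := by
  classical
  ext a b
  simp only [matTensorPow_apply, Matrix.mul_apply, Finset.prod_univ_sum, Fintype.piFinset_univ,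
    Finset.prod_mul_distrib]

theorem matTensorPow_conjTranspose [CommSemiring α] [StarRing α] (n : ℕ) (C : Matrix ι κ α) :
    matTensorPow n C.conjTranspose = (matTensorPow n C).conjTranspose := by
  ext a b
  simp [Matrix.conjTranspose_apply]

theorem matTensorPow_diagonal [CommSemiring α] [DecidableEq ι] (n : ℕ) (d : ι → α) :
    matTensorPow n (Matrix.diagonal d) = Matrix.diagonal fun a => ∏ i, d (a i) := by
  ext a b
  rw [matTensorPow_apply, Matrix.diagonal_apply]
  split_ifs with h
  · subst h; simp
  · obtain ⟨i, hi⟩ := Function.ne_iff.1 h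
    exact Finset.prod_eq_zero (Finset.mem_univ i) (Matrix.diagonal_apply_ne _ hi)

theorem matTensorPow_diagonal_ofReal [DecidableEq ι] (n : ℕ) (d : ι → ℝ) :
    matTensorPow n (Matrix.diagonal fun i => (d i : ℂ)) =
      Matrix.diagonal fun a => ((∏ i, d (a i) : ℝ) : ℂ) := by
  simp only [matTensorPow_diagonal, Complex.ofReal_prod]

theorem matTensorPow_diagonal_ofReal_rpow [DecidableEq ι] (n : ℕ) {d : ι → ℝ} (hd : ∀ i, 0 ≤ d i)
    (t : ℝ) :
    matTensorPow n (Matrix.diagonal fun i => ((d i ^ t : ℝ) : ℂ)) =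
      Matrix.diagonal fun a => (((∏ i, d (a i)) ^ t : ℝ) : ℂ) := by
  simp only [matTensorPow_diagonal_ofReal, Real.finsetProd_rpow _ _ fun _ _ => hd _]

theorem matTensorPow_one [CommSemiring α] [DecidableEq ι] (n : ℕ) :
    matTensorPow n (1 : Matrix ι ι α) = 1 := by
  rw [← Matrix.diagonal_one, matTensorPow_diagonal]
  simp

theorem isHermitian_matTensorPow [CommSemiring α] [StarRing α] {C : Matrix ι ι α}
    (hC : C.IsHermitian) (n : ℕ) : (matTensorPow n C).IsHermitian := by
  rw [Matrix.IsHermitian, ← matTensorPow_conjTranspose, hC.eq]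

theorem posSemidef_matTensorPow [Finite ι] {C : Matrix ι ι ℂ} (hC : C.PosSemidef) (n : ℕ) :
    (matTensorPow n C).PosSemidef := by
  induction n with
  | zero => simpa [matTensorPow_zero, Matrix.vecMulVec] using
      Matrix.posSemidef_vecMulVec_self_star (1 : (Fin 0 → ι) → ℂ)
  | succ n ih =>
    rw [matTensorPow_succ]
    exact (hC.kronecker ih).submatrix _

theorem matTensorPow_le_matTensorPow [Finite ι] {C D : Matrix ι ι ℂ} (hC : C.PosSemidef)
    (hCD : C ≤ D) (n : ℕ) : matTensorPow n C ≤ matTensorPow n D := by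
  have hD : D.PosSemidef := by simpa using (Matrix.le_iff.1 hCD).add hC
  induction n with
  | zero => simp [matTensorPow_zero]
  | succ n ih =>
    have telescope : matTensorPow (n + 1) D - matTensorPow (n + 1) C =
        ((D - C) ⊗ₖ matTensorPow n D + C ⊗ₖ (matTensorPow n D - matTensorPow n C)).submatrix
          (fun a => (a 0, Fin.tail a)) fun b => (b 0, Fin.tail b) := by
      rw [matTensorPow_succ, matTensorPow_succ]
      ext a b
      simp only [Matrix.sub_apply, Matrix.submatrix_apply, Matrix.add_apply,
        Matrix.kroneckerMap_apply]
      ring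
    rw [Matrix.le_iff, telescope]
    exact ((Matrix.le_iff.1 hCD |>.kronecker (posSemidef_matTensorPow hD n)).add
      (hC.kronecker (Matrix.le_iff.1 ih))).submatrix _

theorem continuous_matTensorPow [CommSemiring α] [TopologicalSpace α] [ContinuousMul α] (n : ℕ) :
    Continuous (matTensorPow n : Matrix ι κ α → _) := by
  refine continuous_matrix fun a b => ?_
  simp only [matTensorPow_apply]
  fun_prop

end TensorPower

section QuadForm

variable {ι κ : Type*} [Fintype ι] [Fintype κ]

/-- The real part of `⟨v, C v⟩`, as a real-linear functional of the matrix `C`. -/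
def quadForm (v : ι → ℂ) : Matrix ι ι ℂ →ₗ[ℝ] ℝ where
  toFun C := (star v ⬝ᵥ C.mulVec v).re
  map_add' C D := by simp [Matrix.add_mulVec]
  map_smul' r C := by simp [Matrix.smul_mulVec]

theorem quadForm_apply (v : ι → ℂ) (C : Matrix ι ι ℂ) :
    quadForm v C = (star v ⬝ᵥ C.mulVec v).re := rfl

theorem quadForm_nonneg {C : Matrix ι ι ℂ} (hC : C.PosSemidef) (v : ι → ℂ) : 0 ≤ quadForm v C :=
  hC.re_dotProduct_nonneg v

theorem dotProduct_mulVec_eq_quadForm {C : Matrix ι ι ℂ} (hC : C.IsHermitian) (v : ι → ℂ) :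
    star v ⬝ᵥ C.mulVec v = (quadForm v C : ℂ) := by
  refine Complex.ext rfl ?_
  simpa using hC.im_star_dotProduct_mulVec_self v

theorem quadForm_mono (v : ι → ℂ) : Monotone (quadForm v) := fun C D h => by
  have := quadForm_nonneg (Matrix.le_iff.1 h) v
  rwa [map_sub, sub_nonneg] at this

theorem le_iff_quadForm_le {C D : Matrix ι ι ℂ} (hC : C.IsHermitian) (hD : D.IsHermitian) :
    C ≤ D ↔ ∀ v, quadForm v C ≤ quadForm v D := by
  refine ⟨fun h v => quadForm_mono v h, fun h => ?_⟩
  refine Matrix.le_iff.2 (Matrix.posSemidef_iff_dotProduct_mulVec.2 ⟨hD.sub hC, fun v => ?_⟩)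
  rw [dotProduct_mulVec_eq_quadForm (hD.sub hC), map_sub]
  exact_mod_cast sub_nonneg.2 (h v)

theorem continuous_quadForm (v : ι → ℂ) : Continuous (quadForm v) :=
  (quadForm v).continuous_of_finiteDimensional

theorem quadForm_conj (v : ι → ℂ) (M : Matrix ι κ ℂ) (C : Matrix κ κ ℂ) :
    quadForm v (M * C * M.conjTranspose) = quadForm (M.conjTranspose.mulVec v) C := by
  simp only [quadForm_apply, ← Matrix.mulVec_mulVec, Matrix.star_mulVec, Matrix.dotProduct_mulVec,
    Matrix.vecMul_vecMul, Matrix.conjTranspose_conjTranspose]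

theorem quadForm_matTensorPow_conj (n : ℕ) (w : (Fin n → ι) → ℂ) (M : Matrix ι κ ℂ)
    (C : Matrix κ κ ℂ) :
    quadForm w (matTensorPow n (M * C * M.conjTranspose)) =
      quadForm ((matTensorPow n M).conjTranspose.mulVec w) (matTensorPow n C) := by
  rw [matTensorPow_mul, matTensorPow_mul, matTensorPow_conjTranspose, quadForm_conj]

theorem quadForm_diagonal [DecidableEq ι] (v : ι → ℂ) (d : ι → ℝ) :
    quadForm v (Matrix.diagonal fun i => (d i : ℂ)) = ∑ i, d i * Complex.normSq (v i) := by
  simp only [quadForm_apply, dotProduct, Matrix.mulVec_diagonal, Complex.re_sum]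
  refine Finset.sum_congr rfl fun i _ => ?_
  simp only [Pi.star_apply, RCLike.star_def, Complex.mul_re, Complex.conj_re, Complex.ofReal_re,
    Complex.ofReal_im, Complex.conj_im, Complex.mul_im, Complex.normSq_apply]
  ring

theorem quadForm_one [DecidableEq ι] (v : ι → ℂ) :
    quadForm v 1 = ∑ i, Complex.normSq (v i) := by
  rw [← Matrix.diagonal_one]
  simpa using quadForm_diagonal v fun _ => (1 : ℝ)

theorem quadForm_submatrix (v : κ → ℂ) (e : κ ≃ ι) (C : Matrix ι ι ℂ) :
    quadForm v (C.submatrix e e) = quadForm (v ∘ e.symm) C := by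
  simp only [quadForm_apply, Matrix.submatrix_mulVec_equiv]
  congr 1
  exact Fintype.sum_equiv e _ _ fun i => by simp

theorem quadForm_kronecker {C : Matrix ι ι ℂ} {D : Matrix κ κ ℂ} (hC : C.IsHermitian)
    (hD : D.IsHermitian) (v : ι → ℂ) (w : κ → ℂ) :
    quadForm (fun p : ι × κ => v p.1 * w p.2) (C ⊗ₖ D) = quadForm v C * quadForm w D := by
  have hmulVec : (C ⊗ₖ D).mulVec (fun p => v p.1 * w p.2) =
      fun p => C.mulVec v p.1 * D.mulVec w p.2 := by
    ext p
    simp only [Matrix.mulVec, dotProduct, Finset.sum_mul_sum, Fintype.sum_prod_type,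
      Matrix.kroneckerMap_apply]
    exact Finset.sum_congr rfl fun i _ => Finset.sum_congr rfl fun j _ => by ring
  have hdot : star (fun p : ι × κ => v p.1 * w p.2) ⬝ᵥ (C ⊗ₖ D).mulVec (fun p => v p.1 * w p.2) =
      (star v ⬝ᵥ C.mulVec v) * (star w ⬝ᵥ D.mulVec w) := by
    rw [hmulVec]
    simp only [dotProduct, Finset.sum_mul_sum, Fintype.sum_prod_type, Pi.star_apply, star_mul]
    exact Finset.sum_congr rfl fun i _ => Finset.sum_congr rfl fun j _ => by ring
  rw [dotProduct_mulVec_eq_quadForm hC, dotProduct_mulVec_eq_quadForm hD] at hdot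
  rw [quadForm_apply, hdot, ← Complex.ofReal_mul, Complex.ofReal_re]

theorem quadForm_matTensorPow_append {C : Matrix ι ι ℂ} (hC : C.IsHermitian) (m n : ℕ)
    (v : (Fin m → ι) → ℂ) (w : (Fin n → ι) → ℂ) :
    quadForm (fun a => v (fun i => a (Fin.castAdd n i)) * w fun i => a (Fin.natAdd m i))
        (matTensorPow (m + n) C) =
      quadForm v (matTensorPow m C) * quadForm w (matTensorPow n C) := by
  rw [← quadForm_kronecker (isHermitian_matTensorPow hC m) (isHermitian_matTensorPow hC n),
    matTensorPow_add, quadForm_submatrix]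
  congr 2
  ext p
  simp [Fin.appendEquiv]

theorem quadForm_matTensorPow_prod {C : Matrix ι ι ℂ} (hC : C.IsHermitian) (n : ℕ) (v : ι → ℂ) :
    quadForm (fun a => ∏ i, v (a i)) (matTensorPow n C) = quadForm v C ^ n := by
  classical
  have hdot : star (fun a : Fin n → ι => ∏ i, v (a i)) ⬝ᵥ
      (matTensorPow n C).mulVec (fun a => ∏ i, v (a i)) = (star v ⬝ᵥ C.mulVec v) ^ n := by
    simp only [dotProduct, Matrix.mulVec, matTensorPow_apply, Pi.star_apply, star_prod,
      ← Fin.prod_const, Finset.prod_univ_sum, Fintype.piFinset_univ, Finset.prod_mul_distrib]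
  rw [dotProduct_mulVec_eq_quadForm hC] at hdot
  rw [quadForm_apply, hdot, ← Complex.ofReal_pow, Complex.ofReal_re]

theorem quadForm_sum_le {σ : Type*} {C : Matrix ι ι ℂ} (hC : C.PosSemidef) (s : Finset σ)
    (v : σ → ι → ℂ) : quadForm (∑ k ∈ s, v k) C ≤ s.card * ∑ k ∈ s, quadForm (v k) C := by
  classical
  obtain ⟨D, rfl⟩ := CStarAlgebra.nonneg_iff_eq_star_mul_self.1 hC.nonneg
  have hnorm (x : ι → ℂ) : quadForm x (star D * D) = ∑ i, ‖D.mulVec x i‖ ^ 2 := by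
    have := quadForm_conj x D.conjTranspose 1
    rw [Matrix.mul_one, Matrix.conjTranspose_conjTranspose] at this
    rw [Matrix.star_eq_conjTranspose, this, quadForm_one]
    simp only [Complex.normSq_eq_norm_sq]
  simp only [hnorm]
  rw [Finset.sum_comm, Finset.mul_sum]
  refine Finset.sum_le_sum fun i _ => ?_
  rw [Matrix.mulVec_sum, Finset.sum_apply]
  calc ‖∑ k ∈ s, D.mulVec (v k) i‖ ^ 2 ≤ (∑ k ∈ s, ‖D.mulVec (v k) i‖) ^ 2 := by
        gcongr; exact norm_sum_le _ _
    _ ≤ _ := sq_sum_le_card_mul_sum_sq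

end QuadForm

section Separation

theorem exists_tendsto_inv_smul_of_mem_span {E : Type*} [AddCommGroup E] [Module ℝ E]
    [TopologicalSpace E] [ContinuousAdd E] [ContinuousSMul ℝ E] {K : AddSubmonoid E} {x : E}
    (hx : x ∈ Submodule.span NNReal (K : Set E)) :
    ∃ k : ℕ → E, (∀ n, k n ∈ K) ∧ Tendsto (fun n : ℕ => (n : ℝ)⁻¹ • k n) atTop (𝓝 x) := by
  rw [← Submodule.mem_toAddSubmonoid, Submodule.span_eq_closure] at hx
  induction hx using AddSubmonoid.closure_induction with
  | mem x hx =>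
    obtain ⟨c, -, y, hy, rfl⟩ := hx
    refine ⟨fun n => ⌊(c : ℝ) * n⌋₊ • y, fun n => K.nsmul_mem hy _, ?_⟩
    have hfloor := ((tendsto_nat_floor_mul_div_atTop c.coe_nonneg).comp
      tendsto_natCast_atTop_atTop).smul_const y
    refine hfloor.congr fun n => ?_
    simp only [Function.comp_apply]
    rw [← Nat.cast_smul_eq_nsmul ℝ, smul_smul, inv_mul_eq_div]
  | zero => exact ⟨fun _ => 0, fun _ => K.zero_mem, by simp [tendsto_const_nhds]⟩
  | add x y _ _ hx hy =>
    obtain ⟨k, hk, hkx⟩ := hx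
    obtain ⟨l, hl, hly⟩ := hy
    exact ⟨fun n => k n + l n, fun n => K.add_mem (hk n) (hl n), by simpa using hkx.add hly⟩

theorem disjoint_span_of_disjoint_addSubmonoid {E : Type*} [AddCommGroup E] [Module ℝ E]
    [TopologicalSpace E] [ContinuousAdd E] [ContinuousSMul ℝ E] {O : Set E} (hO : IsOpen O)
    (hOsmul : ∀ n : ℕ, 0 < n → ∀ x ∈ O, n • x ∈ O) {K : AddSubmonoid E}
    (hOK : Disjoint O (K : Set E)) : Disjoint O (Submodule.span NNReal (K : Set E) : Set E) := by
  refine Set.disjoint_left.2 fun x hxO hx => ?_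
  obtain ⟨k, hkK, hkx⟩ := exists_tendsto_inv_smul_of_mem_span hx
  obtain ⟨n, hnO, hn⟩ :=
    ((hkx.eventually (hO.mem_nhds hxO)).and (eventually_gt_atTop 0)).exists
  refine Set.disjoint_left.1 hOK ?_ (hkK n)
  have := hOsmul n hn _ hnO
  rwa [← Nat.cast_smul_eq_nsmul ℝ, smul_inv_smul₀ (by positivity)] at this

theorem nonneg_of_bddBelow_on_addSubmonoid {E : Type*} [AddCommMonoid E] {K : AddSubmonoid E}
    {f : E →+ ℝ} {c : ℝ} (hf : ∀ x ∈ K, c ≤ f x) {x : E} (hx : x ∈ K) : 0 ≤ f x := by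
  by_contra! hneg
  obtain ⟨n, hn⟩ := exists_nat_gt (c / f x)
  rw [div_lt_iff_of_neg hneg] at hn
  have := hf _ (K.nsmul_mem hx n)
  rw [map_nsmul, nsmul_eq_mul] at this
  linarith

variable {Y : Type*}

theorem exists_stdSimplex_sum_mul_eq [Fintype Y] {f : (Y → ℝ) →ₗ[ℝ] ℝ}
    (hf : ∀ x, 0 ≤ x → 0 ≤ f x) (hf1 : 0 < f 1) :
    ∃ μ ∈ stdSimplex ℝ Y, ∀ x, ∑ y, μ y * x y = f x / f 1 := by
  classical
  have hsum (x : Y → ℝ) : f x = ∑ y, f (Pi.single y 1) * x y := by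
    conv_lhs => rw [pi_eq_sum_univ' x]
    simp only [map_sum, map_smul, smul_eq_mul, mul_comm]
  refine ⟨fun y => f (Pi.single y 1) / f 1, ⟨fun y => div_nonneg (hf _ ?_) hf1.le, ?_⟩,
    fun x => ?_⟩
  · exact Pi.single_nonneg.2 zero_le_one
  · rw [← Finset.sum_div, div_eq_one_iff_eq hf1.ne', hsum 1]
    simp
  · simp only [hsum x, Finset.sum_div, div_mul_eq_mul_div]

theorem exists_stdSimplex_nonneg_on_addSubmonoid [Fintype Y] (s : Set Y) (K : AddSubmonoid (Y → ℝ))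
    (hK : ∀ x ∈ K, ∃ y ∈ s, 0 ≤ x y) :
    ∃ μ ∈ stdSimplex ℝ Y, (∀ y ∉ s, μ y = 0) ∧ ∀ x ∈ K, 0 ≤ ∑ y, μ y * x y := by
  let O : Set (Y → ℝ) := s.pi fun _ => Set.Iio 0
  have hOopen : IsOpen O := isOpen_set_pi s.toFinite fun _ _ => isOpen_Iio
  have hOK : Disjoint O (K : Set (Y → ℝ)) := Set.disjoint_left.2 fun x hxO hxK => by
    obtain ⟨y, hys, hy⟩ := hK x hxK
    exact (hxO y hys).not_ge hy
  have hOspan := disjoint_span_of_disjoint_addSubmonoid hOopen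
    (fun n hn x hx y hy => nsmul_neg (Set.mem_Iio.1 (hx y hy)) hn.ne') hOK
  obtain ⟨f, c, hfO, hfspan⟩ := geometric_hahn_banach_open (convex_pi fun y _ => convex_Iio (0 : ℝ))
    hOopen (fun x hx y hy a b ha hb _ => add_mem (Submodule.smul_mem _ ⟨a, ha⟩ hx)
      (Submodule.smul_mem _ ⟨b, hb⟩ hy)) hOspan
  have hc : c ≤ 0 := by simpa using hfspan 0 (zero_mem _)
  have hfclosure : ∀ x, (∀ y ∈ s, x y ≤ 0) → f x ≤ 0 := fun x hx => by
    refine closure_minimal (fun z hz => ((hfO z hz).trans_le hc).le)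
      (isClosed_le f.continuous continuous_const) ?_
    simpa only [O, closure_pi_set, closure_Iio, Set.mem_pi, Set.mem_Iic] using hx
  have hfnonneg : ∀ x, 0 ≤ x → 0 ≤ f x := fun x hx => by
    have := hfclosure (-x) fun y _ => neg_nonpos.2 (hx y)
    simpa using this
  have hf1 : 0 < f 1 := by
    have := (hfO (-1) fun y _ => by simp).trans_le hc
    simpa using this
  obtain ⟨μ, hμ, hμf⟩ := exists_stdSimplex_sum_mul_eq (f := (f : (Y → ℝ) →ₗ[ℝ] ℝ)) hfnonneg hf1
  classical
  refine ⟨μ, hμ, fun y hy => le_antisymm ?_ (hμ.1 y), fun x hx => ?_⟩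
  · have hle : f (Pi.single y 1) ≤ 0 := hfclosure _ fun z hz => by
      rw [Pi.single_eq_of_ne (ne_of_mem_of_not_mem hz hy)]
    have hμy : μ y = f (Pi.single y 1) / f 1 := by
      simpa [Pi.single_apply] using hμf (Pi.single y 1)
    exact hμy.trans_le (div_nonpos_of_nonpos_of_nonneg hle hf1.le)
  · rw [hμf]
    exact div_nonneg (nonneg_of_bddBelow_on_addSubmonoid (f := (f : (Y → ℝ) →+ ℝ))
      (fun x hx => hfspan x (Submodule.subset_span hx)) hx) hf1.le

theorem exists_mem_submonoid_apply_ne_zero [Finite Y] {M : Type*} [CommMonoidWithZero M]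
    (G : Submonoid (Y → M)) : ∃ p ∈ G, ∀ y, p y ≠ 0 → ∀ q ∈ G, q y ≠ 0 := by
  have := Fintype.ofFinite Y
  have hchoice (y : Y) : ∃ p ∈ G, (∃ q ∈ G, q y = 0) → p y = 0 := by
    by_cases h : ∃ q ∈ G, q y = 0
    · obtain ⟨q, hq, hqy⟩ := h
      exact ⟨q, hq, fun _ => hqy⟩
    · exact ⟨1, G.one_mem, fun h' => absurd h' h⟩
  choose p hpG hp using hchoice
  refine ⟨∏ y, p y, G.prod_mem fun y _ => hpG y, fun y hy q hq hqy => hy ?_⟩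
  rw [Finset.prod_apply]
  exact Finset.prod_eq_zero (Finset.mem_univ y) (hp y ⟨q, hq, hqy⟩)

theorem exists_one_le_apply_of_apply_ne_zero [Finite Y] {G : Submonoid (Y → ℝ)}
    (hG : ∀ p ∈ G, 0 ≤ p) (hG1 : ∀ p ∈ G, ∃ y, 1 ≤ p y) {p q : Y → ℝ} (hp : p ∈ G) (hq : q ∈ G) :
    ∃ y, q y ≠ 0 ∧ 1 ≤ p y := by
  by_contra! h
  have hlim : ∀ᶠ k : ℕ in atTop, ∀ y, p y ^ k * q y < 1 := by
    refine eventually_all.2 fun y => ?_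
    by_cases hqy : q y = 0
    · simp [hqy]
    · have := (tendsto_pow_atTop_nhds_zero_of_lt_one (hG p hp y) (h y hqy)).mul_const (q y)
      rw [zero_mul] at this
      exact this.eventually_lt_const one_pos
  obtain ⟨k, hk⟩ := hlim.exists
  obtain ⟨y, hy⟩ := hG1 _ (G.mul_mem (G.pow_mem hp k) hq)
  exact (hk y).not_ge hy

theorem exists_stdSimplex_one_le_prod_rpow [Fintype Y] (G : Submonoid (Y → ℝ))
    (hG : ∀ p ∈ G, 0 ≤ p) (hG1 : ∀ p ∈ G, ∃ y, 1 ≤ p y) :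
    ∃ μ ∈ stdSimplex ℝ Y, ∀ p ∈ G, 1 ≤ ∏ y, p y ^ μ y := by
  obtain ⟨p₀, hp₀, hp₀G⟩ := exists_mem_submonoid_apply_ne_zero G
  have hpos : ∀ p ∈ G, ∀ y ∈ p₀.support, 0 < p y := fun p hp y hy =>
    (hG p hp y).lt_of_ne' (hp₀G y hy p hp)
  let K : AddSubmonoid (Y → ℝ) :=
    { carrier := {x | ∃ p ∈ G, ∀ y ∈ p₀.support, x y = Real.log (p y)}
      zero_mem' := ⟨1, G.one_mem, by simp⟩
      add_mem' := by
        rintro x z ⟨p, hp, hx⟩ ⟨q, hq, hz⟩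
        refine ⟨p * q, G.mul_mem hp hq, fun y hy => ?_⟩
        rw [Pi.add_apply, hx y hy, hz y hy, Pi.mul_apply,
          Real.log_mul (hpos p hp y hy).ne' (hpos q hq y hy).ne'] }
  obtain ⟨μ, hμ, hμsupp, hμK⟩ := exists_stdSimplex_nonneg_on_addSubmonoid p₀.support K (by
    rintro x ⟨p, hp, hx⟩
    obtain ⟨y, hy, h⟩ := exists_one_le_apply_of_apply_ne_zero hG hG1 hp hp₀
    exact ⟨y, hy, by rw [hx y hy]; exact Real.log_nonneg h⟩)
  refine ⟨μ, hμ, fun p hp => ?_⟩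
  have hprod : ∏ y, p y ^ μ y = Real.exp (∑ y, μ y * Real.log (p y)) := by
    rw [Real.exp_sum]
    refine Finset.prod_congr rfl fun y _ => ?_
    by_cases hy : y ∈ p₀.support
    · rw [Real.rpow_def_of_pos (hpos p hp y hy), mul_comm]
    · simp [hμsupp y hy]
  rw [hprod]
  exact Real.one_le_exp (hμK (fun y => Real.log (p y)) ⟨p, hp, fun _ _ => rfl⟩)

theorem exists_stdSimplex_quadForm_le_prod [Fintype Y] {ι : Type*} [Fintype ι]
    {S : Matrix ι ι ℂ} {P : Y → Matrix ι ι ℂ} (hS : S.PosSemidef) (hP : ∀ y, (P y).PosSemidef)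
    (h : ∀ n w, ∃ y, quadForm w (matTensorPow n S) ≤ quadForm w (matTensorPow n (P y))) :
    ∃ μ ∈ stdSimplex ℝ Y, ∀ n w,
      quadForm w (matTensorPow n S) ≤ ∏ y, quadForm w (matTensorPow n (P y)) ^ μ y := by
  have hPn n w y := quadForm_nonneg (posSemidef_matTensorPow (hP y) n) w
  let G : Submonoid (Y → ℝ) :=
    { carrier := {p | ∃ n w, 0 < quadForm w (matTensorPow n S) ∧
        p = fun y => quadForm w (matTensorPow n (P y)) / quadForm w (matTensorPow n S)}
      one_mem' := ⟨0, fun _ => 1, by simp [quadForm_apply, Matrix.mulVec, dotProduct],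
        by ext; simp [quadForm_apply, Matrix.mulVec, dotProduct]⟩
      mul_mem' := by
        rintro _ _ ⟨m, v, hv, rfl⟩ ⟨n, w, hw, rfl⟩
        refine ⟨m + n, fun a => v (fun i => a (Fin.castAdd n i)) * w fun i => a (Fin.natAdd m i),
          ?_, funext fun y => ?_⟩
        · rw [quadForm_matTensorPow_append hS.1]
          exact mul_pos hv hw
        · rw [quadForm_matTensorPow_append hS.1, quadForm_matTensorPow_append (hP y).1,
            Pi.mul_apply, div_mul_div_comm] }
  obtain ⟨μ, hμ, hμG⟩ := exists_stdSimplex_one_le_prod_rpow G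
    (by rintro _ ⟨n, w, hw, rfl⟩ y; exact div_nonneg (hPn n w y) hw.le)
    (by
      rintro _ ⟨n, w, hw, rfl⟩
      obtain ⟨y, hy⟩ := h n w
      exact ⟨y, (one_le_div hw).2 hy⟩)
  refine ⟨μ, hμ, fun n w => ?_⟩
  rcases (quadForm_nonneg (posSemidef_matTensorPow hS n) w).eq_or_lt with h0 | hpos
  · rw [← h0]
    exact Finset.prod_nonneg fun y _ => Real.rpow_nonneg (hPn n w y) _
  · have hratio := hμG _ ⟨n, w, hpos, rfl⟩
    simp only [Real.div_rpow (hPn n w _) hpos.le, Finset.prod_div_distrib] at hratio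
    rwa [← Real.rpow_sum_of_pos hpos, hμ.2, Real.rpow_one, one_le_div hpos] at hratio

end Separation

theorem card_image_prod_le {ι M : Type*} [Fintype ι] [CommMonoid M] [DecidableEq M] (d : ι → M)
    (n : ℕ) :
    (Finset.univ.image fun a : Fin n → ι => ∏ i, d (a i)).card ≤ (n + 1) ^ Fintype.card ι := by
  classical
  have hsubset : (Finset.univ.image fun a : Fin n → ι => ∏ i, d (a i)) ⊆
      Finset.univ.image fun k : ι → Fin (n + 1) => ∏ j, d j ^ (k j : ℕ) := by
    refine Finset.image_subset_iff.2 fun a _ => Finset.mem_image.2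
      ⟨fun j => ⟨(Finset.univ.filter fun i => a i = j).card, ?_⟩, Finset.mem_univ _, ?_⟩
    · exact Nat.lt_succ_of_le ((Finset.card_le_univ _).trans_eq (Fintype.card_fin n))
    · simp only [← Finset.prod_const]
      exact Finset.prod_fiberwise' Finset.univ a d
  calc _ ≤ _ := Finset.card_le_card hsubset
    _ ≤ (Finset.univ : Finset (ι → Fin (n + 1))).card := Finset.card_image_le
    _ = (n + 1) ^ Fintype.card ι := by rw [Finset.card_univ, Fintype.card_fun, Fintype.card_fin]

theorem le_of_forall_pow_le_add_one_pow_mul_pow {s g : ℝ} (hg : 0 ≤ g) (k : ℕ)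
    (h : ∀ n : ℕ, s ^ n ≤ ((n : ℝ) + 1) ^ k * g ^ n) : s ≤ g := by
  by_contra! hlt
  have hs : 0 < s := hg.trans_lt hlt
  have hratio : |g / s| < 1 := by
    rwa [abs_of_nonneg (div_nonneg hg hs.le), div_lt_one hs]
  have hlim := (tendsto_pow_const_mul_const_pow_of_abs_lt_one k hratio).const_mul (2 ^ k)
  rw [mul_zero] at hlim
  obtain ⟨n, hn, hn1⟩ := ((hlim.eventually_lt_const one_pos).and (eventually_ge_atTop 1)).exists
  have hn1' : (1 : ℝ) ≤ n := by exact_mod_cast hn1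
  refine hn.not_ge ?_
  calc 1 ≤ ((n : ℝ) + 1) ^ k * (g / s) ^ n := by
        rw [div_pow, ← mul_div_assoc, one_le_div (pow_pos hs n)]
        exact h n
    _ ≤ (2 * n : ℝ) ^ k * (g / s) ^ n := by gcongr; linarith
    _ = 2 ^ k * (n ^ k * (g / s) ^ n) := by rw [mul_pow, mul_assoc]

section GeomMean

variable {ι : Type*} [Fintype ι]

/-- The asymptotic weighted geometric-mean bound of `S` by `Q` and `P`: all quadratic forms of all
tensor powers of `S` are bounded by the weighted geometric means of those of `Q` and `P`. Among
positive semidefinite `S` it characterizes `S ≤ Q #_t P`, and it behaves well under congruences and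
limits. -/
def TensorGeomBound (t : ℝ) (Q P S : Matrix ι ι ℂ) : Prop :=
  ∀ n w, quadForm w (matTensorPow n S) ≤
    quadForm w (matTensorPow n Q) ^ (1 - t) * quadForm w (matTensorPow n P) ^ t

theorem TensorGeomBound.conj {κ : Type*} [Fintype κ] {t : ℝ} {Q P S : Matrix ι ι ℂ}
    (h : TensorGeomBound t Q P S) (L : Matrix κ ι ℂ) :
    TensorGeomBound t (L * Q * L.conjTranspose) (L * P * L.conjTranspose)
      (L * S * L.conjTranspose) := fun n w => by
  simpa only [quadForm_matTensorPow_conj] using h n _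

theorem TensorGeomBound.mono {t : ℝ} (ht : t ∈ Set.Icc (0 : ℝ) 1) {Q Q' P P' S S' : Matrix ι ι ℂ}
    (hQ : Q.PosSemidef) (hP : P.PosSemidef) (hS : S.PosSemidef) (hQQ' : Q ≤ Q') (hPP' : P ≤ P')
    (hSS' : S ≤ S') (h : TensorGeomBound t Q P S') : TensorGeomBound t Q' P' S := fun n w => by
  have hQn := quadForm_nonneg (posSemidef_matTensorPow hQ n) w
  have hPn := quadForm_nonneg (posSemidef_matTensorPow hP n) w
  have hQQn := quadForm_mono w (matTensorPow_le_matTensorPow hQ hQQ' n)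
  calc quadForm w (matTensorPow n S)
    _ ≤ quadForm w (matTensorPow n S') := quadForm_mono w (matTensorPow_le_matTensorPow hS hSS' n)
    _ ≤ quadForm w (matTensorPow n Q) ^ (1 - t) * quadForm w (matTensorPow n P) ^ t := h n w
    _ ≤ quadForm w (matTensorPow n Q') ^ (1 - t) * quadForm w (matTensorPow n P') ^ t :=
      mul_le_mul (Real.rpow_le_rpow hQn hQQn (sub_nonneg.2 ht.2))
        (Real.rpow_le_rpow hPn (quadForm_mono w (matTensorPow_le_matTensorPow hP hPP' n)) ht.1)
        (Real.rpow_nonneg hPn _) (Real.rpow_nonneg (hQn.trans hQQn) _)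

variable [DecidableEq ι]

theorem TensorGeomBound.conj_iff {t : ℝ} {Q P S L : Matrix ι ι ℂ} (hL : IsUnit L) :
    TensorGeomBound t (L * Q * L.conjTranspose) (L * P * L.conjTranspose)
      (L * S * L.conjTranspose) ↔ TensorGeomBound t Q P S := by
  refine ⟨fun h => ?_, fun h => h.conj L⟩
  obtain ⟨M, hML⟩ := hL.exists_left_inv
  have hcancel (C : Matrix ι ι ℂ) :
      M * (L * C * L.conjTranspose) * M.conjTranspose = C := by
    calc _ = (M * L) * C * (M * L).conjTranspose := by
          simp only [Matrix.conjTranspose_mul, Matrix.mul_assoc]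
      _ = C := by simp [hML]
  simpa only [hcancel] using h.conj M

theorem exists_rpow_eq_of_posDef {X : Matrix ι ι ℂ} (hX : X.PosDef) :
    ∃ (U : Matrix.unitaryGroup ι ℂ) (d : ι → ℝ), (∀ i, 0 < d i) ∧ ∀ t : ℝ,
      X ^ t = U * Matrix.diagonal (fun i => ((d i ^ t : ℝ) : ℂ)) *
        (U : Matrix ι ι ℂ).conjTranspose := by
  refine ⟨hX.1.eigenvectorUnitary, hX.1.eigenvalues, hX.eigenvalues_pos, fun t => ?_⟩
  have hcoe : (RCLike.ofReal ∘ (fun x : ℝ => ((x.toNNReal ^ t : NNReal) : ℝ)) ∘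
      hX.1.eigenvalues : ι → ℂ) = fun i => ((hX.1.eigenvalues i ^ t : ℝ) : ℂ) := by
    ext i
    simp [max_eq_left (hX.eigenvalues_pos i).le]
  rw [CFC.rpow_def, cfc_nnreal_eq_real _ X hX.posSemidef.nonneg, hX.1.cfc_eq,
    Matrix.IsHermitian.cfc, Unitary.conjStarAlgAut_apply, hcoe]
  rfl

theorem geomMeanPosDef_zero {Q P : Matrix ι ι ℂ} (hQ : Q.PosDef) (hP : P.PosSemidef) :
    geomMeanPosDef 0 Q P = Q := by
  have hX : 0 ≤ Q ^ (-1 / 2 : ℝ) * P * Q ^ (-1 / 2 : ℝ) :=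
    conjugate_nonneg_of_nonneg hP.nonneg CFC.rpow_nonneg
  rw [geomMeanPosDef, CFC.rpow_zero _ hX, mul_one, ← CFC.rpow_add hQ.isUnit, add_halves,
    CFC.rpow_one Q hQ.posSemidef.nonneg]

theorem geomMeanPosDef_one {Q P : Matrix ι ι ℂ} (hQ : Q.PosDef) (hP : P.PosSemidef) :
    geomMeanPosDef 1 Q P = P := by
  have hX : 0 ≤ Q ^ (-1 / 2 : ℝ) * P * Q ^ (-1 / 2 : ℝ) :=
    conjugate_nonneg_of_nonneg hP.nonneg CFC.rpow_nonneg
  have hQQ' : Q ^ (1 / 2 : ℝ) * Q ^ (-1 / 2 : ℝ) = 1 := by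
    rw [neg_div, CFC.rpow_mul_rpow_neg _ hQ.isStrictlyPositive]
  have hQ'Q : Q ^ (-1 / 2 : ℝ) * Q ^ (1 / 2 : ℝ) = 1 := by
    rw [neg_div, CFC.rpow_neg_mul_rpow _ hQ.isStrictlyPositive]
  calc geomMeanPosDef 1 Q P
    _ = (Q ^ (1 / 2 : ℝ) * Q ^ (-1 / 2 : ℝ)) * P * (Q ^ (-1 / 2 : ℝ) * Q ^ (1 / 2 : ℝ)) := by
      rw [geomMeanPosDef, CFC.rpow_one _ hX]; simp only [mul_assoc]
    _ = P := by rw [hQQ', hQ'Q, one_mul, mul_one]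

theorem exists_geomMeanPosDef_eq {Q P : Matrix ι ι ℂ} (hQ : Q.PosDef) (hP : P.PosDef) :
    ∃ (L : Matrix ι ι ℂ) (d : ι → ℝ), IsUnit L ∧ (∀ i, 0 < d i) ∧ ∀ t : ℝ,
      geomMeanPosDef t Q P =
        L * Matrix.diagonal (fun i => ((d i ^ t : ℝ) : ℂ)) * L.conjTranspose := by
  have hQpow (t : ℝ) : (Q ^ t).PosDef :=
    ((Matrix.nonneg_iff_posSemidef.1 CFC.rpow_nonneg).posDef_iff_isUnit).2
      (hQ.isUnit.cfcRpow t hQ.posSemidef.nonneg)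
  have hX : (Q ^ (-1 / 2 : ℝ) * P * Q ^ (-1 / 2 : ℝ)).PosDef := by
    have hu := (hQpow (-1 / 2)).isUnit
    refine Matrix.PosSemidef.posDef_iff_isUnit ?_ |>.2 ((hu.mul hP.isUnit).mul hu)
    exact Matrix.nonneg_iff_posSemidef.1
      (conjugate_nonneg_of_nonneg hP.posSemidef.nonneg CFC.rpow_nonneg)
  obtain ⟨U, d, hd, hpow⟩ := exists_rpow_eq_of_posDef hX
  refine ⟨Q ^ (1 / 2 : ℝ) * U, d, (hQpow _).isUnit.mul Unitary.isUnit_coe, hd, fun t => ?_⟩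
  rw [geomMeanPosDef, hpow, Matrix.conjTranspose_mul, (hQpow _).1.eq]
  simp only [mul_assoc]

theorem quadForm_diagonal_rpow_le {d : ι → ℝ} (hd : ∀ i, 0 ≤ d i) {t : ℝ}
    (ht : t ∈ Set.Icc (0 : ℝ) 1) (v : ι → ℂ) :
    quadForm v (Matrix.diagonal fun i => ((d i ^ t : ℝ) : ℂ)) ≤
      quadForm v 1 ^ (1 - t) * quadForm v (Matrix.diagonal fun i => (d i : ℂ)) ^ t := by
  rcases ht.1.eq_or_lt with rfl | ht0
  · simp
  · have hroot (i : ι) : (d i ^ t) ^ t⁻¹ = d i := Real.rpow_rpow_inv (hd i) ht0.ne'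
    have holder := Real.inner_le_weight_mul_Lp_of_nonneg Finset.univ ((one_le_inv₀ ht0).2 ht.2)
      (fun i => Complex.normSq (v i)) (fun i => d i ^ t) (fun _ => Complex.normSq_nonneg _)
      fun i => Real.rpow_nonneg (hd i) t
    simp only [quadForm_diagonal, quadForm_one]
    simpa only [inv_inv, hroot, mul_comm] using holder

theorem tensorGeomBound_diagonal {d : ι → ℝ} (hd : ∀ i, 0 ≤ d i) {t : ℝ}
    (ht : t ∈ Set.Icc (0 : ℝ) 1) :
    TensorGeomBound t 1 (Matrix.diagonal fun i => (d i : ℂ))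
      (Matrix.diagonal fun i => ((d i ^ t : ℝ) : ℂ)) := fun n w => by
  rw [matTensorPow_one, matTensorPow_diagonal_ofReal_rpow n hd, matTensorPow_diagonal_ofReal]
  exact quadForm_diagonal_rpow_le (fun a => Finset.prod_nonneg fun i _ => hd (a i)) ht w

theorem quadForm_diagonal_eq_mul_quadForm_one {e : ι → ℝ} {c : ℝ} {v : ι → ℂ}
    (hv : ∀ i, v i ≠ 0 → e i = c) :
    quadForm v (Matrix.diagonal fun i => (e i : ℂ)) = c * quadForm v 1 := by
  rw [quadForm_diagonal, quadForm_one, Finset.mul_sum]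
  refine Finset.sum_congr rfl fun i _ => ?_
  by_cases hi : v i = 0
  · simp [hi]
  · rw [hv i hi]

theorem quadForm_le_quadForm_diagonal_rpow_of_eigenvector {C : Matrix ι ι ℂ} {e : ι → ℝ} {c : ℝ}
    (hc : 0 ≤ c) {t : ℝ} (ht : t ∈ Set.Icc (0 : ℝ) 1) {v : ι → ℂ} (hv : ∀ i, v i ≠ 0 → e i = c)
    (h : quadForm v C ≤
      quadForm v 1 ^ (1 - t) * quadForm v (Matrix.diagonal fun i => (e i : ℂ)) ^ t) :
    quadForm v C ≤ quadForm v (Matrix.diagonal fun i => ((e i ^ t : ℝ) : ℂ)) := by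
  have hv1 := quadForm_nonneg Matrix.PosSemidef.one v
  calc quadForm v C
    _ ≤ quadForm v 1 ^ (1 - t) * (c * quadForm v 1) ^ t := by
      rwa [quadForm_diagonal_eq_mul_quadForm_one hv] at h
    _ = c ^ t * (quadForm v 1 ^ (1 - t) * quadForm v 1 ^ t) := by
      rw [Real.mul_rpow hc hv1, mul_left_comm]
    _ = c ^ t * quadForm v 1 := by
      rw [← Real.rpow_add_of_nonneg hv1 (sub_nonneg.2 ht.2) ht.1, sub_add_cancel, Real.rpow_one]
    _ = _ := (quadForm_diagonal_eq_mul_quadForm_one fun i hi => by rw [hv i hi]).symm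

/-- Pinching: on each eigenspace of the diagonal matrix the assumed bound is the desired one, and
passing to the sum over the eigenspaces costs a factor equal to their number. -/
theorem quadForm_le_card_mul_quadForm_diagonal_rpow {C : Matrix ι ι ℂ} (hC : C.PosSemidef)
    {e : ι → ℝ} (he : ∀ i, 0 ≤ e i) {t : ℝ} (ht : t ∈ Set.Icc (0 : ℝ) 1)
    (h : ∀ v, quadForm v C ≤
      quadForm v 1 ^ (1 - t) * quadForm v (Matrix.diagonal fun i => (e i : ℂ)) ^ t) (v : ι → ℂ) :
    quadForm v C ≤ (Finset.univ.image e).card *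
      quadForm v (Matrix.diagonal fun i => ((e i ^ t : ℝ) : ℂ)) := by
  let proj (c : ℝ) : ι → ℂ := fun i => if e i = c then v i else 0
  have hdecomp : v = ∑ c ∈ Finset.univ.image e, proj c := by
    ext i
    simp [proj, Finset.sum_apply]
  have hproj : ∀ c ∈ Finset.univ.image e, quadForm (proj c) C ≤
      quadForm (proj c) (Matrix.diagonal fun i => ((e i ^ t : ℝ) : ℂ)) := by
    intro c hc
    obtain ⟨i, -, rfl⟩ := Finset.mem_image.1 hc
    exact quadForm_le_quadForm_diagonal_rpow_of_eigenvector (he i) ht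
      (fun j hj => of_not_not fun hji => hj (if_neg hji)) (h _)
  calc quadForm v C
    _ = quadForm (∑ c ∈ Finset.univ.image e, proj c) C := by rw [← hdecomp]
    _ ≤ (Finset.univ.image e).card * ∑ c ∈ Finset.univ.image e, quadForm (proj c) C :=
      quadForm_sum_le hC _ _
    _ ≤ (Finset.univ.image e).card * ∑ c ∈ Finset.univ.image e,
        quadForm (proj c) (Matrix.diagonal fun i => ((e i ^ t : ℝ) : ℂ)) :=
      mul_le_mul_of_nonneg_left (Finset.sum_le_sum hproj) (Nat.cast_nonneg _)
    _ = _ := by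
      simp only [quadForm_diagonal]
      rw [Finset.sum_comm]
      simp [proj, apply_ite Complex.normSq]

theorem TensorGeomBound.le_diagonal_rpow {S : Matrix ι ι ℂ} (hS : S.PosSemidef) {d : ι → ℝ}
    (hd : ∀ i, 0 ≤ d i) {t : ℝ} (ht : t ∈ Set.Icc (0 : ℝ) 1)
    (h : TensorGeomBound t 1 (Matrix.diagonal fun i => (d i : ℂ)) S) :
    S ≤ Matrix.diagonal fun i => ((d i ^ t : ℝ) : ℂ) := by
  have hD : (Matrix.diagonal fun i => ((d i ^ t : ℝ) : ℂ)).PosSemidef :=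
    Matrix.PosSemidef.diagonal fun i => Complex.zero_le_real.2 (Real.rpow_nonneg (hd i) t)
  refine (le_iff_quadForm_le hS.1 hD.1).2 fun v => ?_
  refine le_of_forall_pow_le_add_one_pow_mul_pow (quadForm_nonneg hD v) (Fintype.card ι) fun n => ?_
  have hDn := quadForm_nonneg (posSemidef_matTensorPow hD n) fun a => ∏ i, v (a i)
  rw [← quadForm_matTensorPow_prod hS.1, ← quadForm_matTensorPow_prod hD.1]
  calc _ ≤ (Finset.univ.image fun a : Fin n → ι => ∏ i, d (a i)).card *
        quadForm (fun a => ∏ i, v (a i))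
          (matTensorPow n (Matrix.diagonal fun i => ((d i ^ t : ℝ) : ℂ))) := by
        rw [matTensorPow_diagonal_ofReal_rpow n hd]
        refine quadForm_le_card_mul_quadForm_diagonal_rpow (posSemidef_matTensorPow hS n)
          (fun a => Finset.prod_nonneg fun i _ => hd (a i)) ht (fun w => ?_) _
        simpa only [matTensorPow_one, matTensorPow_diagonal_ofReal] using h n w
    _ ≤ _ := by
        gcongr
        exact_mod_cast card_image_prod_le d n

theorem le_diagonal_rpow_iff_tensorGeomBound {S : Matrix ι ι ℂ} (hS : S.PosSemidef) {d : ι → ℝ}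
    (hd : ∀ i, 0 ≤ d i) {t : ℝ} (ht : t ∈ Set.Icc (0 : ℝ) 1) :
    S ≤ Matrix.diagonal (fun i => ((d i ^ t : ℝ) : ℂ)) ↔
      TensorGeomBound t 1 (Matrix.diagonal fun i => (d i : ℂ)) S :=
  ⟨fun h => (tensorGeomBound_diagonal hd ht).mono ht Matrix.PosSemidef.one
    (Matrix.PosSemidef.diagonal fun i => Complex.zero_le_real.2 (hd i)) hS le_rfl le_rfl h,
    fun h => h.le_diagonal_rpow hS hd ht⟩

theorem le_geomMeanPosDef_iff_tensorGeomBound {Q P S : Matrix ι ι ℂ} (hQ : Q.PosDef)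
    (hP : P.PosDef) (hS : S.PosSemidef) {t : ℝ} (ht : t ∈ Set.Icc (0 : ℝ) 1) :
    S ≤ geomMeanPosDef t Q P ↔ TensorGeomBound t Q P S := by
  obtain ⟨L, d, hL, hd, hG⟩ := exists_geomMeanPosDef_eq hQ hP
  have hQL : Q = L * 1 * L.conjTranspose := by
    simpa using (geomMeanPosDef_zero hQ hP.posSemidef).symm.trans (hG 0)
  have hPL : P = L * Matrix.diagonal (fun i => (d i : ℂ)) * L.conjTranspose := by
    simpa using (geomMeanPosDef_one hQ hP.posSemidef).symm.trans (hG 1)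
  obtain ⟨M, hLM⟩ := hL.exists_right_inv
  obtain ⟨S', rfl⟩ : ∃ S', S = L * S' * L.conjTranspose := by
    refine ⟨M * S * M.conjTranspose, ?_⟩
    calc S = (L * M) * S * (L * M).conjTranspose := by simp [hLM]
      _ = _ := by simp only [Matrix.conjTranspose_mul, Matrix.mul_assoc]
  have hS' : S'.PosSemidef := (Matrix.IsUnit.posSemidef_star_right_conjugate_iff hL).1 hS
  rw [hG t, hQL, hPL, TensorGeomBound.conj_iff hL,
    ← le_diagonal_rpow_iff_tensorGeomBound hS' (fun i => (hd i).le) ht, Matrix.le_iff,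
    ← Matrix.sub_mul, ← Matrix.mul_sub]
  exact (Matrix.IsUnit.posSemidef_star_right_conjugate_iff hL)

theorem posSemidef_geomMeanPosDef {Q P : Matrix ι ι ℂ} (hQ : Q.PosDef) (hP : P.PosDef) (t : ℝ) :
    (geomMeanPosDef t Q P).PosSemidef := by
  obtain ⟨L, d, -, hd, hG⟩ := exists_geomMeanPosDef_eq hQ hP
  rw [hG]
  refine (Matrix.PosSemidef.diagonal fun i => ?_).mul_mul_conjTranspose_same L
  exact Complex.zero_le_real.2 (Real.rpow_nonneg (hd i).le t)

theorem geomMeanPosDef_mono {Q P Q' P' : Matrix ι ι ℂ} (hQ : Q.PosDef) (hP : P.PosDef)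
    (hQQ' : Q ≤ Q') (hPP' : P ≤ P') {t : ℝ} (ht : t ∈ Set.Icc (0 : ℝ) 1) :
    geomMeanPosDef t Q P ≤ geomMeanPosDef t Q' P' := by
  have hG := posSemidef_geomMeanPosDef hQ hP t
  have hQ' : Q'.PosDef := by simpa using hQ.add_posSemidef (Matrix.le_iff.1 hQQ')
  have hP' : P'.PosDef := by simpa using hP.add_posSemidef (Matrix.le_iff.1 hPP')
  exact (le_geomMeanPosDef_iff_tensorGeomBound hQ' hP' hG ht).2
    (((le_geomMeanPosDef_iff_tensorGeomBound hQ hP hG ht).1 le_rfl).mono ht hQ.posSemidef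
      hP.posSemidef hG hQQ' hPP' le_rfl)

end GeomMean

section KuboAndo

variable {ι : Type*}

instance orderClosedTopology_matrix [Finite ι] : OrderClosedTopology (Matrix ι ι ℂ) where
  isClosed_le' := by
    have := Fintype.ofFinite ι
    simp only [Matrix.le_iff, Matrix.posSemidef_iff_dotProduct_mulVec, Set.ofPred_and,
      Set.ofPred_forall, Matrix.IsHermitian]
    refine (isClosed_eq (by fun_prop) (by fun_prop)).inter (isClosed_iInter fun v => ?_)
    exact isClosed_le continuous_const (by fun_prop)

theorem apply_eq_sum_quadForm [Fintype ι] [DecidableEq ι] {C : Matrix ι ι ℂ}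
    (hC : C.IsHermitian) (i j : ι) :
    C i j = (quadForm (Pi.single i 1 + Pi.single j 1) C -
      quadForm (Pi.single i 1 - Pi.single j 1) C -
      Complex.I * quadForm (Pi.single i 1 + Complex.I • Pi.single j 1) C +
      Complex.I * quadForm (Pi.single i 1 - Complex.I • Pi.single j 1) C) / 4 := by
  have hstar (k : ι) : star (Pi.single k 1 : ι → ℂ) = Pi.single k 1 := by
    rw [← Pi.single_star, star_one]
  have hI : star Complex.I = -Complex.I := Complex.conj_I
  simp only [← dotProduct_mulVec_eq_quadForm hC, star_add, star_sub, star_smul, hstar, hI,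
    Matrix.mulVec_add, Matrix.mulVec_sub, Matrix.mulVec_smul, add_dotProduct, sub_dotProduct,
    dotProduct_add, dotProduct_sub, smul_dotProduct, dotProduct_smul, single_dotProduct,
    Matrix.mulVec_single, Matrix.col_apply, MulOpposite.op_one, one_smul, one_mul, smul_eq_mul]
  linear_combination (C i j - C j i) / 2 * Complex.I_sq

theorem exists_tendsto_of_tendsto_quadForm [Fintype ι] {σ : Type*} {l : Filter σ}
    {f : σ → Matrix ι ι ℂ} (hf : ∀ᶠ s in l, (f s).IsHermitian)
    (h : ∀ v, ∃ r, Tendsto (fun s => quadForm v (f s)) l (𝓝 r)) :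
    ∃ G, Tendsto f l (𝓝 G) := by
  classical
  choose r hr using h
  have hlim v : Tendsto (fun s => (quadForm v (f s) : ℂ)) l (𝓝 (r v : ℂ)) :=
    (Complex.continuous_ofReal.tendsto _).comp (hr v)
  have hentry i j : ∃ g, Tendsto (fun s => f s i j) l (𝓝 g) := by
    refine ⟨_, Tendsto.congr' ?_ (((((hlim (Pi.single i 1 + Pi.single j 1)).sub
      (hlim (Pi.single i 1 - Pi.single j 1))).sub
      ((hlim (Pi.single i 1 + Complex.I • Pi.single j 1)).const_mul Complex.I)).add
      ((hlim (Pi.single i 1 - Complex.I • Pi.single j 1)).const_mul Complex.I)).div_const 4)⟩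
    filter_upwards [hf] with s hs
    exact (apply_eq_sum_quadForm hs i j).symm
  choose G hG using hentry
  exact ⟨G, tendsto_pi_nhds.2 fun i => tendsto_pi_nhds.2 (hG i)⟩

variable [DecidableEq ι]

theorem posDef_add_smul_one {P : Matrix ι ι ℂ} (hP : P.PosSemidef) {ε : ℝ} (hε : 0 < ε) :
    (P + (ε : ℂ) • 1).PosDef :=
  Matrix.PosDef.posSemidef_add hP (Matrix.PosDef.one.smul (Complex.zero_lt_real.2 hε))

theorem monotone_add_smul_one (P : Matrix ι ι ℂ) : Monotone fun ε : ℝ => P + (ε : ℂ) • 1 :=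
  fun ε δ h => by
    rw [Matrix.le_iff, add_sub_add_left_eq_sub, ← sub_smul, ← Complex.ofReal_sub]
    exact Matrix.PosSemidef.one.smul (Complex.zero_le_real.2 (sub_nonneg.2 h))

variable [Fintype ι]

theorem geomMeanPosDef_add_smul_one_mono {Q P : Matrix ι ι ℂ} (hQ : Q.PosSemidef)
    (hP : P.PosSemidef) {t : ℝ} (ht : t ∈ Set.Icc (0 : ℝ) 1) :
    MonotoneOn (fun ε : ℝ => geomMeanPosDef t (Q + (ε : ℂ) • 1) (P + (ε : ℂ) • 1))
      (Set.Ioi 0) := fun _ hε _ _ h =>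
  geomMeanPosDef_mono (posDef_add_smul_one hQ hε) (posDef_add_smul_one hP hε)
    (monotone_add_smul_one Q h) (monotone_add_smul_one P h) ht

theorem exists_isKuboAndoMean {Q P : Matrix ι ι ℂ} (hQ : Q.PosSemidef) (hP : P.PosSemidef) {t : ℝ}
    (ht : t ∈ Set.Icc (0 : ℝ) 1) : ∃ G, IsKuboAndoMean t Q P G := by
  have hpos {ε : ℝ} (hε : 0 < ε) :=
    posSemidef_geomMeanPosDef (posDef_add_smul_one hQ hε) (posDef_add_smul_one hP hε) t
  refine exists_tendsto_of_tendsto_quadForm ?_ fun v => ⟨_, MonotoneOn.tendsto_nhdsGT ?_ ?_⟩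
  · filter_upwards [self_mem_nhdsWithin] with ε hε using (hpos hε).1
  · exact (quadForm_mono v).comp_monotoneOn (geomMeanPosDef_add_smul_one_mono hQ hP ht)
  · refine ⟨0, ?_⟩
    rintro _ ⟨ε, hε, rfl⟩
    exact quadForm_nonneg (hpos hε) v

theorem IsKuboAndoMean.le_iff_forall_le {Q P G S : Matrix ι ι ℂ} {t : ℝ}
    (hG : IsKuboAndoMean t Q P G) (hQ : Q.PosSemidef) (hP : P.PosSemidef)
    (ht : t ∈ Set.Icc (0 : ℝ) 1) :
    S ≤ G ↔ ∀ ε : ℝ, 0 < ε → S ≤ geomMeanPosDef t (Q + (ε : ℂ) • 1) (P + (ε : ℂ) • 1) := by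
  refine ⟨fun h ε hε => h.trans (le_of_tendsto hG ?_), fun h => ge_of_tendsto hG ?_⟩
  · filter_upwards [Ioo_mem_nhdsGT hε] with δ hδ
    exact geomMeanPosDef_add_smul_one_mono hQ hP ht hδ.1 hε hδ.2.le
  · filter_upwards [self_mem_nhdsWithin] with ε hε using h ε hε

theorem tendsto_quadForm_matTensorPow_add_smul_one (P : Matrix ι ι ℂ) (n : ℕ)
    (w : (Fin n → ι) → ℂ) :
    Tendsto (fun ε : ℝ => quadForm w (matTensorPow n (P + (ε : ℂ) • 1))) (𝓝[>] 0)
      (𝓝 (quadForm w (matTensorPow n P))) := by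
  have hcont : Continuous fun ε : ℝ => quadForm w (matTensorPow n (P + (ε : ℂ) • 1)) :=
    (continuous_quadForm w).comp ((continuous_matTensorPow n).comp (by fun_prop))
  simpa using hcont.continuousWithinAt.tendsto (x := 0) (s := Set.Ioi 0)

theorem tensorGeomBound_iff_forall_add_smul_one {Q P S : Matrix ι ι ℂ} (hQ : Q.PosSemidef)
    (hP : P.PosSemidef) (hS : S.PosSemidef) {t : ℝ} (ht : t ∈ Set.Icc (0 : ℝ) 1) :
    TensorGeomBound t Q P S ↔
      ∀ ε : ℝ, 0 < ε → TensorGeomBound t (Q + (ε : ℂ) • 1) (P + (ε : ℂ) • 1) S := by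
  refine ⟨fun h ε hε => h.mono ht hQ hP hS ?_ ?_ le_rfl, fun h n w => ?_⟩
  · simpa using monotone_add_smul_one Q hε.le
  · simpa using monotone_add_smul_one P hε.le
  · refine ge_of_tendsto (((Real.continuous_rpow_const (sub_nonneg.2 ht.2)).tendsto _ |>.comp
      (tendsto_quadForm_matTensorPow_add_smul_one Q n w)).mul
      ((Real.continuous_rpow_const ht.1).tendsto _ |>.comp
        (tendsto_quadForm_matTensorPow_add_smul_one P n w))) ?_
    filter_upwards [self_mem_nhdsWithin] with ε hε using h ε hε n w

theorem IsKuboAndoMean.le_iff_tensorGeomBound {Q P G S : Matrix ι ι ℂ} {t : ℝ}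
    (hG : IsKuboAndoMean t Q P G) (hQ : Q.PosSemidef) (hP : P.PosSemidef) (hS : S.PosSemidef)
    (ht : t ∈ Set.Icc (0 : ℝ) 1) : S ≤ G ↔ TensorGeomBound t Q P S := by
  rw [hG.le_iff_forall_le hQ hP ht, tensorGeomBound_iff_forall_add_smul_one hQ hP hS ht]
  exact forall₂_congr fun ε hε => le_geomMeanPosDef_iff_tensorGeomBound
    (posDef_add_smul_one hQ hε) (posDef_add_smul_one hP hε) hS ht

end KuboAndo

section Choi

theorem posSemidef_sum_blocks {P A : Type*} [Finite P] [Fintype A] {M : Matrix (P × A) (P × A) ℂ}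
    (hM : M.PosSemidef) :
    (Matrix.of fun p q => ∑ a, ∑ a', M (p, a) (q, a')).PosSemidef := by
  classical
  have := Fintype.ofFinite P
  let K : Matrix P (P × A) ℂ := Matrix.of fun p q => if q.1 = p then 1 else 0
  have hK : (Matrix.of fun p q => ∑ a, ∑ a', M (p, a) (q, a')) = K * M * K.conjTranspose := by
    ext p q
    simp only [Matrix.mul_apply, K, Matrix.of_apply, Matrix.conjTranspose_apply,
      Fintype.sum_prod_type_right, apply_ite star, star_one, star_zero, ite_mul, one_mul, zero_mul,
      mul_ite, mul_one, mul_zero, Finset.sum_ite_eq', Finset.mem_univ, if_true]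
    exact Finset.sum_comm
  rw [hK]
  exact hM.mul_mul_conjTranspose_same K

theorem trace_of_prod {ι : Type*} [Fintype ι] {n : ℕ} (X : Fin n → Matrix ι ι ℂ) :
    (Matrix.of fun a a' : Fin n → ι => ∏ i, X i (a i) (a' i)).trace = ∏ i, (X i).trace := by
  simp only [Matrix.trace, Matrix.diag_apply, Matrix.of_apply]
  rw [Finset.prod_univ_sum, Fintype.piFinset_univ]

theorem single_eq_prod_single {ι : Type*} [DecidableEq ι] {n : ℕ} (a a' : Fin n → ι) :
    (Matrix.single a a' 1 : Matrix (Fin n → ι) (Fin n → ι) ℂ) =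
      Matrix.of fun c c' => ∏ i, Matrix.single (a i) (a' i) 1 (c i) (c' i) := by
  ext c c'
  simp [Matrix.single_apply, Finset.prod_ite_zero, funext_iff, forall_and]

variable {A : Type u} {B : Type v} {R : Type w}

theorem idTensor_apply (N : Superop A B) (X : Matrix (R × A) (R × A) ℂ) (p q : R × B) :
    idTensor R N X p q = N (Matrix.of fun a a' => X (p.1, a) (q.1, a')) p.2 q.2 := rfl

/-- The map `N ↦ id_R ⊗ N`, linear in `N`. -/
def idTensorLinear (R : Type w) : Superop A B →ₗ[ℂ] Superop (R × A) (R × B) where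
  toFun := idTensor R
  map_add' _ _ := rfl
  map_smul' _ _ := rfl

theorem idTensorLinear_apply (N : Superop A B) : idTensorLinear R N = idTensor R N := rfl

theorem IsCP.posSemidef_idTensor [Finite R] {N : Superop A B} (hN : IsCP N)
    {X : Matrix (R × A) (R × A) ℂ} (hX : X.PosSemidef) : (idTensor R N X).PosSemidef := by
  obtain ⟨k, ⟨e⟩⟩ := Finite.exists_equiv_fin R
  have h := (hN k _ (hX.submatrix (Prod.map e.symm id))).submatrix (Prod.map e id)
  convert h using 1
  ext p q
  simp [idTensor_apply]

theorem IsCP.posSemidef_apply {N : Superop A B} (hN : IsCP N) {X : Matrix A A ℂ}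
    (hX : X.PosSemidef) : (N X).PosSemidef :=
  (hN 1 _ (hX.submatrix Prod.snd)).submatrix fun b => (0, b)

theorem IsCP.idTensor [Finite R] {N : Superop A B} (hN : IsCP N) : IsCP (idTensor R N) :=
  fun k _ hX => (hN.posSemidef_idTensor (R := Fin k × R)
    (hX.submatrix (Equiv.prodAssoc (Fin k) R A))).submatrix (Equiv.prodAssoc (Fin k) R B).symm

theorem isCP_of_isCP_idTensor [Nonempty R] {N : Superop A B} (hN : IsCP (idTensor R N)) :
    IsCP N := fun k _ hX => by
  obtain ⟨r⟩ := ‹Nonempty R›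
  exact (hN k _ (hX.submatrix fun p : Fin k × R × A => (p.1, p.2.2))).submatrix
    fun p : Fin k × B => (p.1, r, p.2)

theorem IsCP.comp {C : Type w} {M : Superop B C} {N : Superop A B} (hM : IsCP M) (hN : IsCP N) :
    IsCP (M ∘ₗ N) := fun k X hX => hM k _ (hN k X hX)

variable [DecidableEq A]

theorem choi_apply (N : Superop A B) (p q : A × B) :
    choi N p q = N (Matrix.single p.1 q.1 1) p.2 q.2 := rfl

/-- The unnormalized maximally entangled vector `∑ a, e_a ⊗ e_a`. -/
def maxEntangledVec (A : Type*) [DecidableEq A] : A × A → ℂ := fun p => if p.1 = p.2 then 1 else 0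

theorem idTensor_vecMulVec_maxEntangledVec (N : Superop A B) :
    idTensor A N (Matrix.vecMulVec (maxEntangledVec A) (star (maxEntangledVec A))) = choi N := by
  ext p q
  rw [idTensor_apply, choi_apply]
  congr! 2
  ext a a'
  simp only [Matrix.of_apply, Matrix.vecMulVec_apply, maxEntangledVec, Pi.star_apply,
    Matrix.single_apply]
  split_ifs <;> simp_all

theorem IsCP.posSemidef_choi [Finite A] {N : Superop A B} (hN : IsCP N) : (choi N).PosSemidef := by
  rw [← idTensor_vecMulVec_maxEntangledVec]
  exact hN.posSemidef_idTensor (Matrix.posSemidef_vecMulVec_self_star _)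

theorem apply_eq_sum_choi [Fintype A] (N : Superop A B) (Z : Matrix A A ℂ) (b b' : B) :
    N Z b b' = ∑ a, ∑ a', Z a a' * choi N (a, b) (a', b') := by
  have hsingle (a a' : A) : Matrix.single a a' (Z a a') = Z a a' • Matrix.single a a' (1 : ℂ) := by
    rw [Matrix.smul_single, smul_eq_mul, mul_one]
  conv_lhs => rw [Matrix.matrix_eq_sum_single Z]
  simp only [map_sum, Matrix.sum_apply, hsingle, map_smul, Matrix.smul_apply, smul_eq_mul,
    choi_apply]

/-- The Choi isomorphism. -/
def choiEquiv [Fintype A] : Superop A B ≃ₗ[ℂ] Matrix (A × B) (A × B) ℂ where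
  toFun := choi
  map_add' _ _ := rfl
  map_smul' _ _ := rfl
  invFun G :=
    { toFun Z := Matrix.of fun b b' => ∑ a, ∑ a', Z a a' * G (a, b) (a', b')
      map_add' X Y := by
        ext b b'
        simp [add_mul, Finset.sum_add_distrib]
      map_smul' c X := by
        ext b b'
        simp [Finset.mul_sum, mul_assoc] }
  left_inv N := by
    refine LinearMap.ext fun Z => ?_
    ext b b'
    exact (apply_eq_sum_choi N Z b b').symm
  right_inv G := by
    ext ⟨a, b⟩ ⟨a', b'⟩
    simp [choi_apply, Matrix.single_apply, ite_and]

theorem choiEquiv_apply [Fintype A] (N : Superop A B) : choiEquiv N = choi N := rfl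

theorem isCP_iff_posSemidef_choi [Finite A] [Finite B] {N : Superop A B} :
    IsCP N ↔ (choi N).PosSemidef := by
  refine ⟨IsCP.posSemidef_choi, fun hN k X hX => ?_⟩
  have := Fintype.ofFinite A
  have h := posSemidef_sum_blocks ((hX.kronecker hN).submatrix
    fun p : (Fin k × B) × A => ((p.1.1, p.2), (p.2, p.1.2)))
  convert h using 1
  ext p q
  exact apply_eq_sum_choi N _ _ _

theorem cpLe_iff_choi_le [Finite A] [Finite B] {N M : Superop A B} :
    CPLe N M ↔ choi N ≤ choi M :=
  isCP_iff_posSemidef_choi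

theorem choi_tensorPow [Fintype A] (n : ℕ) (N : Superop A B) :
    choi (tensorPow n N) = (matTensorPow n (choi N)).submatrix
      (Equiv.arrowProdEquivProdArrow (Fin n) (fun _ => A) fun _ => B).symm
      (Equiv.arrowProdEquivProdArrow (Fin n) (fun _ => A) fun _ => B).symm := by
  ext ⟨a, b⟩ ⟨a', b'⟩
  rw [choi_apply, single_eq_prod_single, tensorPow_prod]
  rfl

theorem isCP_tensorPow [Fintype A] [Finite B] {N : Superop A B} (hN : IsCP N) (n : ℕ) :
    IsCP (tensorPow n N) := by
  rw [isCP_iff_posSemidef_choi, choi_tensorPow]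
  exact (posSemidef_matTensorPow hN.posSemidef_choi n).submatrix _

theorem isCPTP_tensorPow [Fintype A] [Fintype B] {N : Superop A B} (hN : IsCPTP N) (n : ℕ) :
    IsCPTP (tensorPow n N) := by
  classical
  refine ⟨isCP_tensorPow hN.1 n, fun Z => ?_⟩
  suffices h : Matrix.traceLinearMap _ ℂ ℂ ∘ₗ tensorPow n N = Matrix.traceLinearMap _ ℂ ℂ from
    LinearMap.congr_fun h Z
  refine Matrix.ext_linearMap ℂ fun a a' => LinearMap.ext_ring ?_
  simp only [LinearMap.comp_apply, Matrix.singleLinearMap_apply, Matrix.traceLinearMap_apply]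
  rw [single_eq_prod_single, tensorPow_prod, trace_of_prod, trace_of_prod]
  exact Finset.prod_congr rfl fun i _ => hN.2 _

end Choi

section Supermap

theorem IsCPSupermap.isCP_apply {A A' : Type u} {B B' : Type v}
    {Θ : Superop A B →ₗ[ℂ] Superop A' B'} (hΘ : IsCPSupermap Θ) {N : Superop A B} (hN : IsCP N) :
    IsCP (Θ N) := by
  suffices h : supermapOnHalf Θ (idTensor (Fin 1) N) = idTensor (Fin 1) (Θ N) from
    isCP_of_isCP_idTensor (h ▸ hΘ 1 1 _ hN.idTensor)
  have hblock (c c' d d' : Fin 1) : superopBlock (idTensor (Fin 1) N) c c' d d' = N := by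
    refine LinearMap.ext fun X => ?_
    ext b b'
    simp [superopBlock, idTensor_kronecker, Subsingleton.elim c d, Subsingleton.elim c' d']
  refine LinearMap.ext fun X => ?_
  ext p q
  simp [supermapOnHalf, hblock, idTensor_apply, Subsingleton.elim p.1 0, Subsingleton.elim q.1 0]

theorem eq_sum_single_kronecker {C A : Type*} [Fintype C] [DecidableEq C]
    (X : Matrix (C × A) (C × A) ℂ) :
    X = ∑ c, ∑ c', Matrix.single c c' (1 : ℂ) ⊗ₖ Matrix.of fun a a' => X (c, a) (c', a') := by
  ext p q
  simp [Matrix.sum_apply, Matrix.single_apply, ite_and]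

theorem supermapOnHalf_id {C D : Type w} {A : Type u} {B : Type v} [Fintype C] [DecidableEq C]
    (Λ : Superop (C × A) (D × B)) : supermapOnHalf LinearMap.id Λ = Λ := by
  refine LinearMap.ext fun X => ?_
  ext p q
  conv_rhs => rw [eq_sum_single_kronecker X]
  simp only [map_sum, Matrix.sum_apply]
  rfl

theorem isSuperchannel_id {A : Type u} {B : Type v} [Fintype A] [Fintype B] :
    IsSuperchannel (LinearMap.id : Superop A B →ₗ[ℂ] Superop A B) :=
  ⟨fun _ _ Λ hΛ => (supermapOnHalf_id Λ).symm ▸ hΛ, fun _ hN => hN⟩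

theorem IsSuperchannel.isTensorPowSuperchannel {A A' : Type u} {B B' : Type v} [Fintype A]
    [DecidableEq A] [Fintype A'] [Fintype B] [Fintype B'] {n : ℕ}
    {Θ : Superop (Fin n → A) (Fin n → B) →ₗ[ℂ] Superop A' B'} (hΘ : IsSuperchannel Θ) :
    IsTensorPowSuperchannel n Θ :=
  ⟨hΘ.1, fun _ hN => hΘ.2 _ (isCPTP_tensorPow hN n)⟩

end Supermap

section Reindex

/-- The channel that relabels the basis along `e`. -/
def reindexSuperop {A : Type u} {B : Type v} (e : A ≃ B) : Superop A B where
  toFun X := X.submatrix e.symm e.symm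
  map_add' _ _ := rfl
  map_smul' _ _ := rfl

variable {A : Type u} {B : Type v}

theorem reindexSuperop_apply (e : A ≃ B) (X : Matrix A A ℂ) :
    reindexSuperop e X = X.submatrix e.symm e.symm := rfl

theorem isCP_reindexSuperop (e : A ≃ B) : IsCP (reindexSuperop e) :=
  fun _ _ hX => hX.submatrix (Prod.map id e.symm)

theorem isCPTP_reindexSuperop [Fintype A] [Fintype B] (e : A ≃ B) : IsCPTP (reindexSuperop e) :=
  ⟨isCP_reindexSuperop e, fun X => e.symm.sum_comp fun a => X a a⟩

theorem trace_mul_reindexSuperop [Fintype A] [Fintype B] (e : A ≃ B) (T : Matrix B B ℂ)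
    (X : Matrix A A ℂ) :
    (T * reindexSuperop e X).trace = (reindexSuperop e.symm T * X).trace := by
  rw [← (isCPTP_reindexSuperop e).2 (reindexSuperop e.symm T * X)]
  simp only [reindexSuperop_apply, Equiv.symm_symm, ← Matrix.submatrix_mul_equiv _ _ _ e.symm,
    Matrix.submatrix_submatrix, Equiv.self_comp_symm, Matrix.submatrix_id_id]

theorem IsTest.reindexSuperop [DecidableEq A] [DecidableEq B] {T : Matrix A A ℂ} (hT : IsTest T)
    (e : A ≃ B) : IsTest (reindexSuperop e T) :=
  ⟨hT.1.submatrix e.symm, by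
    simpa [reindexSuperop_apply, Matrix.submatrix_sub] using hT.2.submatrix e.symm⟩

theorem IsCPTP.isState_apply [Fintype A] [Fintype B] {N : Superop A B} (hN : IsCPTP N)
    {φ : Matrix A A ℂ} (hφ : IsState φ) : IsState (N φ) :=
  ⟨hN.1.posSemidef_apply hφ.1, (hN.2 φ).trans hφ.2⟩

theorem IsCP.monotone {N : Superop A B} (hN : IsCP N) : Monotone N := fun X Y h => by
  rw [Matrix.le_iff, ← map_sub]
  exact hN.posSemidef_apply h

end Reindex

section LinkProduct

variable {A : Type u} {B : Type v} {R : Type w}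

/-- The contraction that applies a superoperator given by its Choi matrix to half of a bipartite
operator (the link product): `C(F) ⊗ X` is mapped to `(id_R ⊗ F)(X)`. -/
def linkContraction (A : Type u) (B : Type v) (R : Type w) [Fintype A] :
    Superop ((A × B) × (R × A)) (R × B) where
  toFun X := Matrix.of fun p q => ∑ a, ∑ a', X ((a, p.2), (p.1, a)) ((a', q.2), (q.1, a'))
  map_add' X Y := by
    ext p q
    simp [Finset.sum_add_distrib]
  map_smul' c X := by
    ext p q
    simp [Finset.mul_sum]

theorem linkContraction_choi_kronecker [Fintype A] [DecidableEq A] (F : Superop A B)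
    (X : Matrix (R × A) (R × A) ℂ) :
    linkContraction A B R (choi F ⊗ₖ X) = idTensor R F X := by
  ext p q
  rw [idTensor_apply, apply_eq_sum_choi F]
  simp only [linkContraction, LinearMap.coe_mk, AddHom.coe_mk, Matrix.of_apply,
    Matrix.kroneckerMap_apply, mul_comm]

theorem isCP_linkContraction [Fintype A] [Finite B] [Finite R] : IsCP (linkContraction A B R) := by
  intro k X hX
  have h := posSemidef_sum_blocks (hX.submatrix
    fun p : (Fin k × (R × B)) × A => (p.1.1, ((p.2, p.1.2.2), (p.1.2.1, p.2))))
  exact h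

theorem exists_isCP_apply_of_one_eq {ι : Type*} [Unique ι] [Finite R] {φ : Matrix R R ℂ}
    (hφ : φ.PosSemidef) : ∃ P : Superop ι R, IsCP P ∧ P (Matrix.of fun _ _ => 1) = φ :=
  ⟨LinearMap.toSpanSingleton ℂ _ φ ∘ₗ Matrix.entryLinearMap ℂ ℂ default default,
    fun k _ hX => (hX.submatrix fun p => (p, default)).kronecker hφ, by simp⟩

theorem exists_isCP_matTensorPow_succ_eq_idTensor [Finite A] [DecidableEq A] [Finite B]
    [Finite R] {k : ℕ} {P : Superop (Fin k → A × B) (R × A)} (hP : IsCP P) :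
    ∃ P' : Superop (Fin (k + 1) → A × B) (R × B), IsCP P' ∧ ∀ F : Superop A B,
      P' (matTensorPow (k + 1) (choi F)) = idTensor R F (P (matTensorPow k (choi F))) := by
  have := Fintype.ofFinite A
  refine ⟨linkContraction A B R ∘ₗ idTensor (A × B) P ∘ₗ
    reindexSuperop (Fin.consEquiv fun _ => A × B).symm,
    isCP_linkContraction.comp (hP.idTensor.comp (isCP_reindexSuperop _)), fun F => ?_⟩
  have hcons : reindexSuperop (Fin.consEquiv fun _ => A × B).symm
      (matTensorPow (k + 1) (choi F)) = choi F ⊗ₖ matTensorPow k (choi F) := by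
    ext p q
    rw [matTensorPow_succ]
    rfl
  rw [LinearMap.comp_apply, LinearMap.comp_apply, hcons, idTensor_kronecker,
    linkContraction_choi_kronecker]

theorem exists_isCP_adaptiveSuperop_eq [Finite A] [DecidableEq A] [Finite B] {R : ℕ → Type w}
    [∀ i, Finite (R i)] {𝒜 : ∀ i, Superop (R i × B) (R (i + 1) × A)}
    {φ : Matrix (R 0 × A) (R 0 × A) ℂ} (hφ : φ.PosSemidef) {k : ℕ} (h𝒜 : ∀ i < k, IsCP (𝒜 i)) :
    ∃ P : Superop (Fin (k + 1) → A × B) (R k × B), IsCP P ∧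
      ∀ F : Superop A B, adaptiveSuperop F R 𝒜 k φ = P (matTensorPow (k + 1) (choi F)) := by
  induction k with
  | zero =>
    obtain ⟨P₀, hP₀, hφP₀⟩ := exists_isCP_apply_of_one_eq (ι := Fin 0 → A × B) hφ
    obtain ⟨P, hP, hPF⟩ := exists_isCP_matTensorPow_succ_eq_idTensor hP₀
    exact ⟨P, hP, fun F => by rw [hPF, matTensorPow_zero, hφP₀, adaptiveSuperop]⟩
  | succ k ih =>
    obtain ⟨P, hP, hPF⟩ := ih fun i hi => h𝒜 i (hi.trans k.lt_succ_self)
    obtain ⟨P', hP', hPF'⟩ :=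
      exists_isCP_matTensorPow_succ_eq_idTensor ((h𝒜 k k.lt_succ_self).comp hP)
    exact ⟨P', hP', fun F => by
      rw [hPF', adaptiveSuperop, LinearMap.comp_apply, LinearMap.comp_apply, hPF,
        LinearMap.comp_apply]⟩

end LinkProduct

section ParallelAsAdaptive

theorem adaptiveSuperop_succ {A : Type u} {B : Type v} (E : Superop A B) (R : ℕ → Type w)
    (𝒜 : ∀ i, Superop (R i × B) (R (i + 1) × A)) (k : ℕ) :
    adaptiveSuperop E R 𝒜 (k + 1) =
      adaptiveSuperop E (fun i => R (i + 1)) (fun i => 𝒜 (i + 1)) k ∘ₗ 𝒜 0 ∘ₗ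
        idTensor (R 0) E := by
  induction k with
  | zero => rfl
  | succ k ih => rw [adaptiveSuperop, ih]; rfl

/-- Moves the first of `n + 1` tensor factors to the reference system `R`. -/
def prodFinSuccEquiv (R : Type w) (A : Type u) (n : ℕ) :
    R × (Fin (n + 1) → A) ≃ (R × A) × (Fin n → A) where
  toFun s := ((s.1, s.2 0), Fin.tail s.2)
  invFun s := (s.1.1, Fin.cons s.1.2 s.2)
  left_inv s := by simp
  right_inv s := by simp

/-- Exchanges the last two of three tensor factors. -/
def prodRightCommEquiv (R A B : Type*) : (R × A) × B ≃ (R × B) × A where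
  toFun s := ((s.1.1, s.2), s.1.2)
  invFun s := ((s.1.1, s.2), s.1.2)

theorem tensorPow_apply {A : Type u} {B : Type v} [Fintype A] [DecidableEq A] (n : ℕ)
    (F : Superop A B) (X : Matrix (Fin n → A) (Fin n → A) ℂ) (b b' : Fin n → B) :
    tensorPow n F X b b' = ∑ a, ∑ a', X a a' * ∏ i, choi F (a i, b i) (a' i, b' i) :=
  Finset.sum_congr rfl fun _ _ => Finset.sum_congr rfl fun _ _ => mul_comm _ _

theorem sum_fin_succ_fun {A M : Type*} [Fintype A] [AddCommMonoid M] {n : ℕ}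
    (f : (Fin (n + 1) → A) → M) : ∑ a, f a = ∑ a : Fin n → A, ∑ x : A, f (Fin.cons x a) := by
  rw [← Fintype.sum_prod_type_right fun p : A × (Fin n → A) => f (Fin.cons p.1 p.2)]
  exact ((Fin.consEquiv fun _ => A).sum_comp f).symm

theorem idTensor_tensorPow_succ {A : Type u} {B : Type v} {R : Type w} [Fintype A]
    [DecidableEq A] (n : ℕ) (F : Superop A B) :
    idTensor R (tensorPow (n + 1) F) =
      reindexSuperop (prodFinSuccEquiv R B n).symm ∘ₗ idTensor (R × B) (tensorPow n F) ∘ₗ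
        reindexSuperop (prodRightCommEquiv R (Fin n → A) B) ∘ₗ idTensor (R × (Fin n → A)) F ∘ₗ
          reindexSuperop ((prodFinSuccEquiv R A n).trans (prodRightCommEquiv R A (Fin n → A))) := by
  refine LinearMap.ext fun X => ?_
  ext p q
  simp only [LinearMap.comp_apply, reindexSuperop_apply, Matrix.submatrix_apply, idTensor_apply,
    tensorPow_apply, sum_fin_succ_fun (n := n), apply_eq_sum_choi F, Finset.sum_mul,
    Matrix.of_apply]
  refine Finset.sum_congr rfl fun a _ => Finset.sum_comm.trans <|
    Finset.sum_congr rfl fun a' _ => Finset.sum_congr rfl fun x _ =>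
      Finset.sum_congr rfl fun x' _ => ?_
  simp only [Fin.prod_univ_succ, Fin.cons_zero, Fin.cons_succ, ← mul_assoc]
  rfl

/-- Parallel uses are adaptive uses: the tensor factors that are not yet used are kept in the
reference system. -/
theorem exists_reindexSuperop_comp_adaptiveSuperop_eq {A B : Type u} [Fintype A] [DecidableEq A]
    [Fintype B] (m : ℕ) (R : Type u) [Finite R] :
    ∃ (S : ℕ → Type u) (_ : ∀ i, Fintype (S i)) (𝒜 : ∀ i, Superop (S i × B) (S (i + 1) × A))
      (e : R × (Fin (m + 1) → A) ≃ S 0 × A) (f : S m × B ≃ R × (Fin (m + 1) → B)),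
      (∀ i < m, IsCPTP (𝒜 i)) ∧ ∀ F : Superop A B,
        reindexSuperop f ∘ₗ adaptiveSuperop F S 𝒜 m ∘ₗ reindexSuperop e =
        idTensor R (tensorPow (m + 1) F) := by
  induction m generalizing R with
  | zero =>
    refine ⟨fun _ => R, fun _ => Fintype.ofFinite R, fun _ => 0,
      (Equiv.refl R).prodCongr (Equiv.funUnique (Fin 1) A),
      (Equiv.refl R).prodCongr (Equiv.funUnique (Fin 1) B).symm,
      fun i hi => absurd hi (Nat.not_lt_zero i), fun F => LinearMap.ext fun X => ?_⟩
    ext p q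
    simp only [adaptiveSuperop, LinearMap.comp_apply, reindexSuperop_apply,
      Matrix.submatrix_apply, idTensor_apply, apply_eq_sum_choi F, tensorPow_apply]
    refine Fintype.sum_equiv (Equiv.funUnique (Fin 1) A).symm _ _ fun a =>
      Fintype.sum_equiv (Equiv.funUnique (Fin 1) A).symm _ _ fun a' => ?_
    simp [Equiv.prodCongr_symm]
  | succ m ih =>
    obtain ⟨S, _, 𝒜, e, f, h𝒜, hS⟩ := ih (R × B)
    have := Fintype.ofFinite R
    let S' : ℕ → Type u := fun i => Nat.casesOn i (R × (Fin (m + 1) → A)) S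
    let 𝒜' : ∀ i, Superop (S' i × B) (S' (i + 1) × A) := fun
      | 0 => reindexSuperop ((prodRightCommEquiv R (Fin (m + 1) → A) B).trans e)
      | i + 1 => 𝒜 i
    refine ⟨S', Nat.rec (inferInstanceAs (Fintype (R × (Fin (m + 1) → A)))) inferInstance, 𝒜',
      (prodFinSuccEquiv R A (m + 1)).trans (prodRightCommEquiv R A (Fin (m + 1) → A)),
      f.trans (prodFinSuccEquiv R B (m + 1)).symm, ?_, fun F => ?_⟩
    · rintro (_ | i) hi
      exacts [isCPTP_reindexSuperop ((prodRightCommEquiv R (Fin (m + 1) → A) B).trans e),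
        h𝒜 i (Nat.lt_of_succ_lt_succ hi)]
    · rw [adaptiveSuperop_succ, idTensor_tensorPow_succ, ← hS F]
      rfl

end ParallelAsAdaptive

section RankOneProj

variable {ι : Type*} [Fintype ι] [DecidableEq ι] {v : ι → ℂ}

theorem quadForm_one_pos (hv : v ≠ 0) : 0 < quadForm v 1 := by
  obtain ⟨i, hi⟩ := Function.ne_iff.1 hv
  rw [quadForm_one]
  exact Finset.sum_pos' (fun j _ => Complex.normSq_nonneg _)
    ⟨i, Finset.mem_univ i, Complex.normSq_pos.2 hi⟩

theorem star_dotProduct_self_eq_quadForm_one (v : ι → ℂ) : star v ⬝ᵥ v = (quadForm v 1 : ℂ) := by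
  rw [← dotProduct_mulVec_eq_quadForm Matrix.isHermitian_one, Matrix.one_mulVec]

/-- The orthogonal projection onto the line spanned by `v`; it serves both as a pure state and as
a test. For `v = 0` it is zero, as `0⁻¹ = 0`. -/
noncomputable def rankOneProj (v : ι → ℂ) : Matrix ι ι ℂ :=
  (quadForm v 1)⁻¹ • Matrix.vecMulVec v (star v)

theorem trace_rankOneProj (hv : v ≠ 0) : (rankOneProj v).trace = 1 := by
  rw [rankOneProj, Matrix.trace_smul, Matrix.trace_vecMulVec, dotProduct_comm,
    star_dotProduct_self_eq_quadForm_one, Complex.real_smul, ← Complex.ofReal_mul,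
    inv_mul_cancel₀ (quadForm_one_pos hv).ne', Complex.ofReal_one]

theorem isStarProjection_rankOneProj (v : ι → ℂ) : IsStarProjection (rankOneProj v) where
  isSelfAdjoint := (IsSelfAdjoint.all _).smul
    (Matrix.posSemidef_vecMulVec_self_star v).isHermitian.isSelfAdjoint
  isIdempotentElem := by
    have hself : Matrix.vecMulVec v (star v) * Matrix.vecMulVec v (star v) =
        quadForm v 1 • Matrix.vecMulVec v (star v) := by
      rw [Matrix.vecMulVec_mul_vecMulVec, star_dotProduct_self_eq_quadForm_one]
      ext i j
      simp [Matrix.vecMulVec_apply, mul_left_comm]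
    rw [IsIdempotentElem, rankOneProj, smul_mul_smul_comm, hself, smul_smul]
    congr 1
    simpa using mul_self_mul_inv (quadForm v 1)⁻¹

theorem isState_rankOneProj {ι : Type u} [Fintype ι] [DecidableEq ι] {v : ι → ℂ} (hv : v ≠ 0) :
    IsState (rankOneProj v) :=
  ⟨Matrix.nonneg_iff_posSemidef.1 (isStarProjection_rankOneProj v).nonneg, trace_rankOneProj hv⟩

theorem isTest_rankOneProj {ι : Type u} [Fintype ι] [DecidableEq ι] (v : ι → ℂ) :
    IsTest (rankOneProj v) :=
  ⟨Matrix.nonneg_iff_posSemidef.1 (isStarProjection_rankOneProj v).nonneg,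
    Matrix.nonneg_iff_posSemidef.1 (isStarProjection_rankOneProj v).one_sub.nonneg⟩

theorem re_trace_rankOneProj_mul (v : ι → ℂ) (X : Matrix ι ι ℂ) :
    (rankOneProj v * X).trace.re = (quadForm v 1)⁻¹ * quadForm v X := by
  rw [rankOneProj, Matrix.smul_mul, Matrix.trace_smul, Complex.smul_re, smul_eq_mul,
    Matrix.vecMulVec_mul, Matrix.trace_vecMulVec, dotProduct_comm, ← Matrix.dotProduct_mulVec,
    quadForm_apply v X]

end RankOneProj

section Mixture

variable {ι : Type*} {Y : Type*} [Fintype Y] {μ : Y → ℝ}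

theorem re_trace_mul_nonneg [Fintype ι] {T X : Matrix ι ι ℂ} (hT : T.PosSemidef)
    (hX : X.PosSemidef) : 0 ≤ (T * X).trace.re := by
  classical
  obtain ⟨D, rfl⟩ := CStarAlgebra.nonneg_iff_eq_star_mul_self.1 (Matrix.nonneg_iff_posSemidef.2 hT)
  rw [Matrix.star_eq_conjTranspose, Matrix.mul_assoc, Matrix.trace_mul_comm]
  exact (Complex.nonneg_iff.1 (hX.mul_mul_conjTranspose_same D).trace_nonneg).1

theorem re_trace_mul_le_sup' [Nonempty Y] [Fintype ι] (hμ : μ ∈ stdSimplex ℝ Y)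
    {T X : Matrix ι ι ℂ} {Z : Y → Matrix ι ι ℂ} (hT : T.PosSemidef)
    (h : X ≤ ∑ y, (μ y : ℂ) • Z y) :
    (T * X).trace.re ≤ Finset.univ.sup' Finset.univ_nonempty fun y => (T * Z y).trace.re := by
  set M := Finset.univ.sup' Finset.univ_nonempty fun y => (T * Z y).trace.re
  calc (T * X).trace.re
    _ ≤ (T * ∑ y, (μ y : ℂ) • Z y).trace.re := by
        rw [← sub_nonneg, ← Complex.sub_re, ← Matrix.trace_sub, ← Matrix.mul_sub]
        exact re_trace_mul_nonneg hT h
    _ = ∑ y, μ y * (T * Z y).trace.re := by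
        simp only [Matrix.mul_sum, Matrix.trace_sum, Matrix.mul_smul, Matrix.trace_smul,
          smul_eq_mul, Complex.re_sum, Complex.re_ofReal_mul]
    _ ≤ ∑ y, μ y * M := Finset.sum_le_sum fun y _ => mul_le_mul_of_nonneg_left
        (Finset.le_sup' (fun y => (T * Z y).trace.re) (Finset.mem_univ y)) (hμ.1 y)
    _ = M := by rw [← Finset.sum_mul, hμ.2, one_mul]

theorem quadForm_sum_smul [Fintype ι] (w : ι → ℂ) (μ : Y → ℝ) (C : Y → Matrix ι ι ℂ) :
    quadForm w (∑ y, (μ y : ℂ) • C y) = ∑ y, μ y * quadForm w (C y) := by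
  simp only [map_sum, Complex.coe_smul, map_smul, smul_eq_mul]

theorem posSemidef_sum_smul (hμ : μ ∈ stdSimplex ℝ Y) {C : Y → Matrix ι ι ℂ}
    (hC : ∀ y, (C y).PosSemidef) : (∑ y, (μ y : ℂ) • C y).PosSemidef :=
  Matrix.posSemidef_sum _ fun y _ => (hC y).smul (Complex.zero_le_real.2 (hμ.1 y))

theorem cpLe_tensorPow_sum_iff {A B : Type*} [Fintype A] [DecidableEq A] [Finite B]
    {N : Y → Superop A B} {E : Superop A B} {n : ℕ} :
    CPLe (tensorPow n E) (∑ y, (μ y : ℂ) • tensorPow n (N y)) ↔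
      matTensorPow n (choi E) ≤ ∑ y, (μ y : ℂ) • matTensorPow n (choi (N y)) := by
  have hchoi : choi (∑ y, (μ y : ℂ) • tensorPow n (N y)) =
      (∑ y, (μ y : ℂ) • matTensorPow n (choi (N y))).submatrix
        (Equiv.arrowProdEquivProdArrow (Fin n) (fun _ => A) fun _ => B).symm
        (Equiv.arrowProdEquivProdArrow (Fin n) (fun _ => A) fun _ => B).symm := by
    rw [← choiEquiv_apply, map_sum]
    simp only [map_smul, choiEquiv_apply, choi_tensorPow]
    ext p q
    simp [Matrix.sum_apply]
  rw [cpLe_iff_choi_le, hchoi, choi_tensorPow, Matrix.le_iff, Matrix.le_iff,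
    ← Matrix.posSemidef_submatrix_equiv
      (Equiv.arrowProdEquivProdArrow (Fin n) (fun _ => A) fun _ => B).symm]
  rfl

end Mixture

section Implications

variable {A B : Type u} [Fintype A] [DecidableEq A] [Fintype B] {Y : Type v} [Fintype Y]

/-- A single probability measure `μ` on `Y` for which the quadratic forms of the tensor powers of
the Choi matrix of `E` are at most the `μ`-weighted geometric means of those of the `N y`. This
links the operational conditions to both `DominatedMixture` and, for two maps, the Kubo–Ando
means. -/
def DominatedGeometric (N : Y → Superop A B) (E : Superop A B) : Prop :=
  ∃ μ ∈ stdSimplex ℝ Y, ∀ n w, quadForm w (matTensorPow n (choi E)) ≤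
    ∏ y, quadForm w (matTensorPow n (choi (N y))) ^ μ y

variable {N : Y → Superop A B} {E : Superop A B}

theorem DominatedGeometric.dominatedMixture (hN : ∀ y, IsCP (N y)) (hE : IsCP E)
    (h : DominatedGeometric N E) : DominatedMixture N E := by
  obtain ⟨μ, hμ, hle⟩ := h
  have hNn n y := posSemidef_matTensorPow (hN y).posSemidef_choi n
  refine ⟨μ, hμ, fun n _ => cpLe_tensorPow_sum_iff.2 <| (le_iff_quadForm_le
    (isHermitian_matTensorPow hE.posSemidef_choi.1 n)
    (posSemidef_sum_smul hμ (hNn n)).1).2 fun w => (hle n w).trans ?_⟩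
  rw [quadForm_sum_smul]
  exact Real.geom_mean_le_arith_mean_weighted _ _ _ (fun y _ => hμ.1 y) hμ.2
    fun y _ => quadForm_nonneg (hNn n y) w

variable [Nonempty Y]

theorem DominatedTensorPowGeneral.dominatedGeneral (h : DominatedTensorPowGeneral N E) :
    DominatedGeneral N E :=
  fun n hn R A' B' _ _ _ _ _ _ Θ φ T hΘ hφ hT =>
    h n hn R A' B' Θ φ T hΘ.isTensorPowSuperchannel hφ hT

theorem DominatedGeneral.dominatedParallel [DecidableEq B] (h : DominatedGeneral N E) :
    DominatedParallel N E :=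
  fun n hn R _ _ φ T hφ hT =>
    h n hn R (Fin n → A) (Fin n → B) LinearMap.id φ T isSuperchannel_id hφ hT

theorem DominatedAdaptive.dominatedParallel [DecidableEq B] (h : DominatedAdaptive N E) :
    DominatedParallel N E := by
  classical
  rintro (_ | m) hn R _ _ φ T hφ hT
  · exact absurd hn (Nat.not_succ_le_zero 0)
  obtain ⟨S, _, 𝒜, e, f, h𝒜, hS⟩ := exists_reindexSuperop_comp_adaptiveSuperop_eq
    (A := A) (B := B) m R
  have hadaptive := h m S 𝒜 (reindexSuperop e φ) (reindexSuperop f.symm T) h𝒜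
    ((isCPTP_reindexSuperop e).isState_apply hφ) (hT.reindexSuperop f.symm)
  simpa only [← hS, LinearMap.comp_apply, trace_mul_reindexSuperop] using hadaptive

theorem DominatedMixture.dominatedTensorPowGeneral (h : DominatedMixture N E) :
    DominatedTensorPowGeneral N E := by
  obtain ⟨μ, hμ, hle⟩ := h
  intro n hn R A' B' _ _ _ _ _ _ Θ φ T hΘ hφ hT
  refine re_trace_mul_le_sup' hμ hT.1 ?_
  have hdiff := (hΘ.1.isCP_apply (hle n hn)).posSemidef_idTensor (R := R) hφ.1
  rw [← idTensorLinear_apply] at hdiff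
  simpa only [map_sub, map_sum, map_smul, LinearMap.sub_apply, LinearMap.sum_apply,
    LinearMap.smul_apply, idTensorLinear_apply, ← Matrix.le_iff] using hdiff

theorem DominatedMixture.dominatedAdaptive [DecidableEq B] (h : DominatedMixture N E) :
    DominatedAdaptive N E := by
  obtain ⟨μ, hμ, hle⟩ := h
  intro m R _ _ 𝒜 φ T h𝒜 hφ hT
  obtain ⟨P, hP, hPF⟩ := exists_isCP_adaptiveSuperop_eq hφ.1 fun i hi => (h𝒜 i hi).1
  simp only [hPF]
  refine re_trace_mul_le_sup' hμ hT.1 ?_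
  simpa only [map_sum, map_smul] using
    hP.monotone (cpLe_tensorPow_sum_iff.1 (hle (m + 1) m.succ_pos))

theorem DominatedParallel.exists_quadForm_le [DecidableEq B] (h : DominatedParallel N E) (n : ℕ)
    (w : (Fin n → A × B) → ℂ) :
    ∃ y, quadForm w (matTensorPow n (choi E)) ≤ quadForm w (matTensorPow n (choi (N y))) := by
  rcases n.eq_zero_or_pos with rfl | hn
  · simp only [matTensorPow_zero, le_refl, exists_const]
  rcases eq_or_ne w 0 with rfl | hw
  · simp only [quadForm_apply, Matrix.mulVec_zero, dotProduct_zero, le_refl, exists_const]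
  let e := Equiv.arrowProdEquivProdArrow (Fin n) (fun _ => A) fun _ => B
  let Ψ := maxEntangledVec (Fin n → A)
  let v := w ∘ e.symm
  obtain ⟨x, hx⟩ := Function.ne_iff.1 hw
  have hΨ : Ψ ≠ 0 := Function.ne_iff.2 ⟨((e x).1, (e x).1), by simp [Ψ, maxEntangledVec]⟩
  have hv : v ≠ 0 := Function.ne_iff.2 ⟨e x, by simpa [v] using hx⟩
  have hvalue (F : Superop A B) :
      (rankOneProj v * idTensor (Fin n → A) (tensorPow n F) (rankOneProj Ψ)).trace.re =
        (quadForm Ψ 1)⁻¹ * (quadForm v 1)⁻¹ * quadForm w (matTensorPow n (choi F)) := by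
    have hchoi : idTensor (Fin n → A) (tensorPow n F) (rankOneProj Ψ) =
        (quadForm Ψ 1)⁻¹ • choi (tensorPow n F) := by
      rw [rankOneProj, ← Complex.coe_smul, map_smul, idTensor_vecMulVec_maxEntangledVec,
        Complex.coe_smul]
    rw [hchoi, re_trace_rankOneProj_mul, map_smul, choi_tensorPow, quadForm_submatrix,
      smul_eq_mul, mul_left_comm, mul_assoc]
    rfl
  obtain ⟨y, -, hy⟩ := (Finset.le_sup'_iff _).1
    (h n hn (Fin n → A) _ _ (isState_rankOneProj hΨ) (isTest_rankOneProj v))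
  rw [hvalue, hvalue] at hy
  exact ⟨y, le_of_mul_le_mul_left hy
    (mul_pos (inv_pos.2 (quadForm_one_pos hΨ)) (inv_pos.2 (quadForm_one_pos hv)))⟩

theorem DominatedParallel.dominatedGeometric [DecidableEq B] (hN : ∀ y, IsCP (N y)) (hE : IsCP E)
    (h : DominatedParallel N E) : DominatedGeometric N E :=
  exists_stdSimplex_quadForm_le_prod hE.posSemidef_choi (fun y => (hN y).posSemidef_choi)
    h.exists_quadForm_le

end Implications

section TwoPoint

theorem univ_eq_pair {Y : Type*} [Fintype Y] [DecidableEq Y] {y₁ y₂ : Y}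
    (hY : ∀ y, y = y₁ ∨ y = y₂) : (Finset.univ : Finset Y) = {y₁, y₂} := by
  ext y
  simpa using hY y

theorem exists_stdSimplex_iff_of_pair {Y : Type*} [Fintype Y] {y₁ y₂ : Y} (hne : y₁ ≠ y₂)
    (hY : ∀ y, y = y₁ ∨ y = y₂) {p : ℝ → ℝ → Prop} :
    (∃ μ ∈ stdSimplex ℝ Y, p (μ y₁) (μ y₂)) ↔ ∃ t ∈ Set.Icc (0 : ℝ) 1, p t (1 - t) := by
  classical
  constructor
  · rintro ⟨μ, hμ, hp⟩
    have hsum := hμ.2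
    rw [univ_eq_pair hY, Finset.sum_pair hne] at hsum
    refine ⟨μ y₁, ⟨hμ.1 y₁, by linarith [hμ.1 y₂]⟩, ?_⟩
    rwa [← hsum, add_sub_cancel_left]
  · rintro ⟨t, ht, hp⟩
    refine ⟨fun y => if y = y₁ then t else 1 - t, ⟨fun y => ?_, ?_⟩, ?_⟩
    · dsimp only
      split_ifs
      exacts [ht.1, sub_nonneg.2 ht.2]
    · rw [univ_eq_pair hY, Finset.sum_pair hne, if_pos rfl, if_neg hne.symm, add_sub_cancel]
    · simpa only [if_pos, if_neg hne.symm] using hp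

variable {A B : Type u} [Fintype A] [DecidableEq A] [Fintype B]

theorem dominatedGeometric_iff_exists_tensorGeomBound {Y : Type v} [Fintype Y]
    {N : Y → Superop A B} {E : Superop A B} {y₁ y₂ : Y} (hne : y₁ ≠ y₂)
    (hY : ∀ y, y = y₁ ∨ y = y₂) :
    DominatedGeometric N E ↔ ∃ t ∈ Set.Icc (0 : ℝ) 1,
      TensorGeomBound t (choi (N y₂)) (choi (N y₁)) (choi E) := by
  classical
  simp only [DominatedGeometric, TensorGeomBound, univ_eq_pair hY, Finset.prod_pair hne]
  rw [exists_stdSimplex_iff_of_pair hne hY (p := fun s t => ∀ n w,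
    quadForm w (matTensorPow n (choi E)) ≤ quadForm w (matTensorPow n (choi (N y₁))) ^ s *
      quadForm w (matTensorPow n (choi (N y₂))) ^ t)]
  simp only [mul_comm]

theorem exists_isKuboAndoMeanCP_iff_tensorGeomBound [DecidableEq B] {M N E : Superop A B}
    (hM : IsCP M) (hN : IsCP N) (hE : IsCP E) {t : ℝ} (ht : t ∈ Set.Icc (0 : ℝ) 1) :
    (∃ G, IsKuboAndoMeanCP t M N G ∧ CPLe E G) ↔ TensorGeomBound t (choi M) (choi N) (choi E) := by
  have hle (G : Superop A B) (hG : IsKuboAndoMeanCP t M N G) :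
      CPLe E G ↔ TensorGeomBound t (choi M) (choi N) (choi E) :=
    cpLe_iff_choi_le.trans <| hG.le_iff_tensorGeomBound hM.posSemidef_choi hN.posSemidef_choi
      hE.posSemidef_choi ht
  refine ⟨fun ⟨G, hG, hEG⟩ => (hle G hG).1 hEG, fun h => ?_⟩
  obtain ⟨C, hC⟩ := exists_isKuboAndoMean hM.posSemidef_choi hN.posSemidef_choi ht
  have hG : IsKuboAndoMeanCP t M N (choiEquiv.symm C) := by
    rwa [IsKuboAndoMeanCP, ← choiEquiv_apply (choiEquiv.symm C), LinearEquiv.apply_symm_apply]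
  exact ⟨_, hG, (hle _ hG).2 h⟩

theorem dominatedGeometric_iff_exists_isKuboAndoMeanCP [DecidableEq B] {Y : Type v} [Fintype Y]
    {N : Y → Superop A B} {E : Superop A B} (hN : ∀ y, IsCP (N y)) (hE : IsCP E) {y₁ y₂ : Y}
    (hne : y₁ ≠ y₂) (hY : ∀ y, y = y₁ ∨ y = y₂) :
    DominatedGeometric N E ↔ ∃ t ∈ Set.Icc (0 : ℝ) 1, ∃ G : Superop A B,
      IsKuboAndoMeanCP t (N y₂) (N y₁) G ∧ CPLe E G :=
  (dominatedGeometric_iff_exists_tensorGeomBound hne hY).trans <| exists_congr fun _ =>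
    and_congr_right fun ht =>
      (exists_isKuboAndoMeanCP_iff_tensorGeomBound (hN y₂) (hN y₁) hE ht).symm

end TwoPoint

theorem mainTheorem11 {A B : Type u} [Fintype A] [DecidableEq A] [Fintype B] [DecidableEq B]
    {Y : Type v} [Fintype Y] [Nonempty Y] (N : Y → Superop A B) (E : Superop A B)
    (hN : ∀ y, IsCP (N y)) (hE : IsCP E) :
    [DominatedGeneral N E, DominatedTensorPowGeneral N E, DominatedAdaptive N E,
      DominatedParallel N E, DominatedMixture N E].TFAE ∧
    ∀ y₁ y₂ : Y, y₁ ≠ y₂ → (∀ y, y = y₁ ∨ y = y₂) →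
      [DominatedGeneral N E, DominatedTensorPowGeneral N E, DominatedAdaptive N E,
        DominatedParallel N E, DominatedMixture N E,
        ∃ t ∈ Set.Icc (0 : ℝ) 1, ∃ G : Superop A B,
          IsKuboAndoMeanCP t (N y₂) (N y₁) G ∧ CPLe E G].TFAE := by
  have h : [DominatedGeneral N E, DominatedTensorPowGeneral N E, DominatedAdaptive N E,
      DominatedParallel N E, DominatedMixture N E].TFAE := by
    tfae_have 5 → 2 := DominatedMixture.dominatedTensorPowGeneral
    tfae_have 2 → 1 := DominatedTensorPowGeneral.dominatedGeneral
    tfae_have 1 → 4 := DominatedGeneral.dominatedParallel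
    tfae_have 5 → 3 := DominatedMixture.dominatedAdaptive
    tfae_have 3 → 4 := DominatedAdaptive.dominatedParallel
    tfae_have 4 → 5 := fun h => (h.dominatedGeometric hN hE).dominatedMixture hN hE
    tfae_finish
  refine ⟨h, fun y₁ y₂ hne hY => ?_⟩
  have hmean := dominatedGeometric_iff_exists_isKuboAndoMeanCP hN hE hne hY
  tfae_have 1 ↔ 2 := h.out 0 1
  tfae_have 1 ↔ 3 := h.out 0 2
  tfae_have 1 ↔ 4 := h.out 0 3
  tfae_have 1 ↔ 5 := h.out 0 4
  tfae_have 4 → 6 := fun h => hmean.1 (h.dominatedGeometric hN hE)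
  tfae_have 6 → 5 := fun h => (hmean.2 h).dominatedMixture hN hE
  tfae_finish
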